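/- Let $G=(V,E)$ be a finite simple graph and $c:E\to\mathbb R$. Let $\mathcal V$ be the set of one-element subsets of $V$ and $\mathcal O$ the set of odd subsets of $V$ of size at least $3$. For $\mathcal F\subseteq\mathcal O$ consider the linear program $P_{\mathcal F}(G,c)$: minimize $\sum_{e\in E}c(e)x(e)$ subject to $x(\delta(u))=1$ for all $u\in V$, $x(\delta(S))\ge 1$ for all $S\in\mathcal F$, $x\ge 0$; and its dual $D_{\mathcal F}(G,c)$: maximize $\sum_{S\in\mathcal V\cup\mathcal F}\Pi(S)$ subject to $\sum_{S\in\mathcal V\cup\mathcal F:\,e\in\delta(S)}\Pi(S)\le c(e)$ for all $e\in E$ and $\Pi(S)\ge 0$ for all $S\in\mathcal F$. Here $\delta(S)$ is the set of edges with exactly one endpoint in $S$. Dual vectors are extended by $0$ to all other subsets of $V$. For a dual feasible $\Pi$, let $G_\Pi$ be the graph on $V$ whose edges are the $e\in E$ with equality in the dual constraint. A set $S\in\mathcal F$ is $(\Pi,\mathcal F)$-factor-critical if for every $u\in S$ there is a matching $M$ in $G_\Pi$ covering precisely $S\setminus\{u\}$ with $|M\cap\delta(T)|\le 1$ for all $T\in\mathcal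 F$. A feasible solution $\Pi$ of $D_{\mathcal F}(G,c)$ is an $\mathcal F$-critical dual if every $S\in\mathcal F$ is $(\Pi,\mathcal F)$-factor-critical and $\Pi(T)>0$ for every non-maximal $T\in\mathcal F$. It is an $\mathcal F$-positively-critical dual if every $S\in\mathcal F$ with $\Pi(S)>0$ is $(\Pi,\mathcal F)$-factor-critical. A family $\mathcal F\subseteq\mathcal O$ is a critical family if it is laminar (any two members are disjoint or comparable) and an $\mathcal F$-critical dual exists. Given a feasible solution $\Gamma$ of $D_{\mathcal F}(G,c)$, an optimal solution $\Pi$ of $D_{\mathcal F}(G,c)$ is called $\Gamma$-extremal if it minimizes $\sum_{S\in\mathcal V\cup\mathcal F}|\Pi(S)-\Gamma(S)|/|S|$ among all optimal solutions of $D_{\mathcal F}(G,c)$. **Lemma.** Let $\mathcal F$ be a critical family, $\Gamma$ an $\mathcal F$-critical dual, and $\Pi$ a $\Gamma$-extremal optimal solution of $D_{\mathcal F}(G,c)$. Then $\Pi$ is an $\mathcal F$-positively-critical optimal solution of $D_{\mathcal F}(G,c)$. Moreover, suppose that $P_{\mathcal F}(G,c)$ has a unique optimal solution $x$. Let $\mathcal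 H'=\{S\in\mathcal F:\Pi(S)>0\}$; for every odd cycle $C$ in $\mathrm{supp}(x)=\{e\in E:x(e)>0\}$ let $\hat C$ be the union of $V(C)$ and all maximal sets of $\mathcal H'$ that intersect $V(C)$; let $\mathcal H''$ be the set of all these $\hat C$; and let $\mathcal H=\mathcal H'\cup\mathcal H''$. Then $\mathcal H$ is a critical family and $\Pi$ is an $\mathcal H$-critical dual (in particular feasible for $D_{\mathcal H}(G,c)$). -/

import Mathlib

namespace Blossom

noncomputable section

open Classical in
/-- The cut `δ(S)`: the edges of `G` with exactly one endpoint in `S`. -/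
def cut {V : Type*} [Fintype V] [DecidableEq V] (G : SimpleGraph V) (S : Finset V) :
    Finset (Sym2 V) :=
  {e | e ∈ G.edgeSet ∧ ∃ u v, u ∈ S ∧ v ∉ S ∧ e = s(u, v)}

/-- The one-element subsets of the vertex set. -/
def singletons (V : Type*) [Fintype V] [DecidableEq V] : Finset (Finset V) :=
  Finset.univ.image fun v => {v}

/-- `F` consists of odd vertex sets of size at least three. -/
def IsOddFamily {V : Type*} (F : Finset (Finset V)) : Prop :=
  ∀ S ∈ F, Odd S.card ∧ 3 ≤ S.card

/-- Any two members of the family are disjoint or comparable. -/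
def IsLaminar {V : Type*} (F : Finset (Finset V)) : Prop :=
  ∀ X ∈ F, ∀ Y ∈ F, Disjoint X Y ∨ X ⊆ Y ∨ Y ⊆ X

/-! ### The primal program `P_F(G, c)`

Vectors indexed by the edges of `G` are functions on all unordered pairs that vanish outside the
edge set. -/

/-- Feasibility for `P_F(G, c)`: degree constraints, blossom inequalities, non-negativity. -/
structure IsPrimalFeasible {V : Type*} [Fintype V] [DecidableEq V] (G : SimpleGraph V)
    (F : Finset (Finset V)) (x : Sym2 V → ℝ) : Prop where
  eq_zero : ∀ e, e ∉ G.edgeSet → x e = 0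
  degree : ∀ u : V, ∑ e ∈ cut G {u}, x e = 1
  blossom : ∀ S ∈ F, 1 ≤ ∑ e ∈ cut G S, x e
  nonneg : ∀ e, 0 ≤ x e

open Classical in
/-- The cost `∑_{e ∈ E} c(e) x(e)`. -/
def primalCost {V : Type*} [Fintype V] [DecidableEq V] (G : SimpleGraph V)
    (c x : Sym2 V → ℝ) : ℝ :=
  ∑ e with e ∈ G.edgeSet, c e * x e

/-- `x` is an optimal solution of `P_F(G, c)`. -/
def IsPrimalOptimal {V : Type*} [Fintype V] [DecidableEq V] (G : SimpleGraph V)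
    (c : Sym2 V → ℝ) (F : Finset (Finset V)) (x : Sym2 V → ℝ) : Prop :=
  IsPrimalFeasible G F x ∧ ∀ y, IsPrimalFeasible G F y → primalCost G c x ≤ primalCost G c y

/-- `x` is the unique optimal solution of `P_F(G, c)`. -/
def IsUniquePrimalOptimal {V : Type*} [Fintype V] [DecidableEq V] (G : SimpleGraph V)
    (c : Sym2 V → ℝ) (F : Finset (Finset V)) (x : Sym2 V → ℝ) : Prop :=
  IsPrimalOptimal G c F x ∧ ∀ y, IsPrimalOptimal G c F y → y = x

/-! ### The dual program `D_F(G, c)`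

Vectors indexed by the singletons and the members of `F` are functions on all vertex sets that
vanish on every other set. -/

open Classical in
/-- The left-hand side of the dual constraint of the edge `e`: the total dual value of the
singletons and members of `F` whose cut contains `e`. -/
def dualLoad {V : Type*} [Fintype V] [DecidableEq V] (G : SimpleGraph V)
    (F : Finset (Finset V)) (P : Finset V → ℝ) (e : Sym2 V) : ℝ :=
  ∑ S ∈ singletons V ∪ F with e ∈ cut G S, P S

/-- Feasibility for `D_F(G, c)`; the values on singletons are free. -/
structure IsDualFeasible {V : Type*} [Fintype V] [DecidableEq V] (G : SimpleGraph V)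
    (c : Sym2 V → ℝ) (F : Finset (Finset V)) (P : Finset V → ℝ) : Prop where
  eq_zero : ∀ S, S ∉ singletons V ∪ F → P S = 0
  edge : ∀ e ∈ G.edgeSet, dualLoad G F P e ≤ c e
  nonneg : ∀ S ∈ F, 0 ≤ P S

/-- The objective of `D_F(G, c)`. -/
def dualValue {V : Type*} [Fintype V] [DecidableEq V] (F : Finset (Finset V))
    (P : Finset V → ℝ) : ℝ :=
  ∑ S ∈ singletons V ∪ F, P S

/-- `P` is an optimal solution of `D_F(G, c)`. -/
def IsDualOptimal {V : Type*} [Fintype V] [DecidableEq V] (G : SimpleGraph V)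
    (c : Sym2 V → ℝ) (F : Finset (Finset V)) (P : Finset V → ℝ) : Prop :=
  IsDualFeasible G c F P ∧ ∀ Q, IsDualFeasible G c F Q → dualValue F Q ≤ dualValue F P

/-- The weighted distance `h(P, Γ) = ∑_S |P(S) - Γ(S)| / |S|`. -/
def dualDist {V : Type*} [Fintype V] [DecidableEq V] (F : Finset (Finset V))
    (P Γ : Finset V → ℝ) : ℝ :=
  ∑ S ∈ singletons V ∪ F, |P S - Γ S| / (S.card : ℝ)

/-- `P` is a `Γ`-extremal dual optimal solution: among all optimal solutions of `D_F(G, c)` it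
minimizes the distance to `Γ`. -/
def IsExtremalDual {V : Type*} [Fintype V] [DecidableEq V] (G : SimpleGraph V)
    (c : Sym2 V → ℝ) (F : Finset (Finset V)) (Γ P : Finset V → ℝ) : Prop :=
  IsDualOptimal G c F P ∧ ∀ Q, IsDualOptimal G c F Q → dualDist F P Γ ≤ dualDist F Q Γ

/-! ### Factor-critical sets and critical families -/

/-- `G_P`: the graph of the edges of `G` that are tight for `P` in `D_F(G, c)`. -/
def tightGraph {V : Type*} [Fintype V] [DecidableEq V] (G : SimpleGraph V)
    (c : Sym2 V → ℝ) (F : Finset (Finset V)) (P : Finset V → ℝ) : SimpleGraph V :=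
  SimpleGraph.fromEdgeSet {e | e ∈ G.edgeSet ∧ dualLoad G F P e = c e}

/-- `M` is a `(U, F)`-perfect-matching of the graph `H`: a matching that covers precisely `U` and
has at most one edge in the cut of every member of `F`. -/
def IsPerfectMatchingOn {V : Type*} [Fintype V] [DecidableEq V] {H : SimpleGraph V}
    (M : H.Subgraph) (U : Finset V) (F : Finset (Finset V)) : Prop :=
  M.IsMatching ∧ M.verts = (U : Set V) ∧
    ∀ S ∈ F, (M.edgeSet ∩ (cut H S : Set (Sym2 V))).ncard ≤ 1

/-- `S` is `(H, F)`-factor-critical: for every `u ∈ S` the graph `H` has an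
`(S \ {u}, F)`-perfect-matching. -/
def IsFactorCritical {V : Type*} [Fintype V] [DecidableEq V] (H : SimpleGraph V)
    (F : Finset (Finset V)) (S : Finset V) : Prop :=
  ∀ u ∈ S, ∃ M : H.Subgraph, IsPerfectMatchingOn M (S \ {u}) F

/-- `P` is an `F`-critical dual: it is feasible for `D_F(G, c)`, every member of `F` is
factor-critical in the graph of tight edges, and `P` is positive on the non-maximal members. -/
structure IsCriticalDual {V : Type*} [Fintype V] [DecidableEq V] (G : SimpleGraph V)
    (c : Sym2 V → ℝ) (F : Finset (Finset V)) (P : Finset V → ℝ) : Prop where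
  feasible : IsDualFeasible G c F P
  factorCritical : ∀ S ∈ F, IsFactorCritical (tightGraph G c F P) F S
  pos : ∀ T ∈ F, ¬ Maximal (fun S => S ∈ F) T → 0 < P T

/-- `P` is an `F`-positively-critical dual: it is feasible for `D_F(G, c)`, and every member of
`F` on which it is positive is factor-critical in the graph of tight edges. -/
structure IsPositivelyCriticalDual {V : Type*} [Fintype V] [DecidableEq V] (G : SimpleGraph V)
    (c : Sym2 V → ℝ) (F : Finset (Finset V)) (P : Finset V → ℝ) : Prop where
  feasible : IsDualFeasible G c F P
  factorCritical : ∀ S ∈ F, 0 < P S → IsFactorCritical (tightGraph G c F P) F S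

/-- A critical family: a laminar family of odd sets of size at least three that has a critical
dual. -/
structure IsCriticalFamily {V : Type*} [Fintype V] [DecidableEq V] (G : SimpleGraph V)
    (c : Sym2 V → ℝ) (F : Finset (Finset V)) : Prop where
  odd : IsOddFamily F
  laminar : IsLaminar F
  exists_dual : ∃ P, IsCriticalDual G c F P

/-! ### The choice of the next cuts -/

open Classical in
/-- The retained cuts `H'`: the members of `F` with positive dual value. -/
def oldCuts {V : Type*} (F : Finset (Finset V)) (P : Finset V → ℝ) : Finset (Finset V) :=
  {S ∈ F | 0 < P S}

/-- `supp(x)` as a graph. -/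
def supportGraph {V : Type*} (x : Sym2 V → ℝ) : SimpleGraph V :=
  SimpleGraph.fromEdgeSet {e | 0 < x e}

/-- `U` is the vertex set of an odd cycle in `supp(x)`. -/
def IsOddCycleSet {V : Type*} [DecidableEq V] (x : Sym2 V → ℝ) (U : Finset V) : Prop :=
  ∃ (v : V) (p : (supportGraph x).Walk v v), p.IsCycle ∧ Odd p.length ∧ p.support.toFinset = U

open Classical in
/-- The union of `U` with the maximal members of `K` that intersect it. -/
def hull {V : Type*} [DecidableEq V] (K : Finset (Finset V)) (U : Finset V) : Finset V :=
  U ∪ {S ∈ K | Maximal (fun T => T ∈ K) S ∧ (S ∩ U).Nonempty}.biUnion id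

open Classical in
/-- The new cuts `H''`: one set for every odd cycle in `supp(x)`, namely the union of its vertex
set with the maximal retained cuts that intersect it. -/
def newCuts {V : Type*} [Fintype V] [DecidableEq V] (F : Finset (Finset V))
    (P : Finset V → ℝ) (x : Sym2 V → ℝ) : Finset (Finset V) :=
  {U : Finset V | IsOddCycleSet x U}.toFinset.image (hull (oldCuts F P))

/-- The next cut family `H = H' ∪ H''`. -/
def nextCuts {V : Type*} [Fintype V] [DecidableEq V] (F : Finset (Finset V))
    (P : Finset V → ℝ) (x : Sym2 V → ℝ) : Finset (Finset V) :=
  oldCuts F P ∪ newCuts F P x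

end

end Blossom

/-! Positive criticality comes from a perturbation argument. Let `P S > 0`. Strictly inside `S`,
move `P` a little towards `Γ`, and change the value at `S` so that the objective is preserved. Edges
inside `S` see a convex combination of two feasible loads. For an edge leaving `S` at `a`, the
near-perfect matching of `S` missing `a` that is tight for `Γ` shows that its load does not grow.
The new vector is therefore optimal. Because of the weights `1/|T|`, moving mass from smaller sets
to `S` would strictly reduce the distance to `Γ`, so extremality forces `P = Γ` strictly inside `S`
(`IsExtremalDual.eq_of_ssubset`). The matchings that witness criticality of `Γ` are then tight for
`P` as well.

For the next family, complementary slackness makes `supp(x)` tight for `P` and gives value one to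
the cuts of the sets with `P > 0`. Uniqueness makes `x` half-integral: after contracting the maximal
sets with cut value one, Birkhoff's theorem supplies a half-integral solution supported in
`supp(x)`, its extension by near-perfect matchings satisfies the same tight constraints, and `x` is
a vertex (`IsUniquePrimalOptimal.half_integral`). Hence an odd cycle has no further support edges at
its vertices.

Now partition `V` into the maximal retained cuts and the remaining singletons; `x` is the extension
of its outer part by near-perfect matchings of the parts (`IsNodeMap.eq_lift_outer`). Parity shows
that a cycle meets each part it touches in an odd number of vertices and that no other odd cycle
touches this part (`IsDecomposition.circuit_unique`), so the new cuts are pairwise equal or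
disjoint. A near-perfect matching of the cycle, extended into the parts, gives the near-perfect
matchings of the new cut (`IsDecomposition.exists_matching_hull`). -/

namespace Blossom

/-! ### Cuts, the handshake identity and matchings as edge sets -/

section Basics

set_option linter.unusedSectionVars false

variable {V : Type*} [Fintype V] [DecidableEq V] {G : SimpleGraph V}

theorem mem_cut {S : Finset V} {e : Sym2 V} :
    e ∈ cut G S ↔ e ∈ G.edgeSet ∧ ∃ u v, u ∈ S ∧ v ∉ S ∧ e = s(u, v) := by
  simp [cut]

theorem mk_mem_cut {S : Finset V} {a b : V} :
    s(a, b) ∈ cut G S ↔ G.Adj a b ∧ (a ∈ S ∧ b ∉ S ∨ b ∈ S ∧ a ∉ S) := by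
  rw [mem_cut, SimpleGraph.mem_edgeSet]
  refine and_congr_right fun _ => ⟨?_, ?_⟩
  · rintro ⟨u, v, hu, hv, h⟩
    rcases Sym2.eq_iff.1 h with ⟨rfl, rfl⟩ | ⟨rfl, rfl⟩
    · exact Or.inl ⟨hu, hv⟩
    · exact Or.inr ⟨hu, hv⟩
  · rintro (⟨h1, h2⟩ | ⟨h1, h2⟩)
    · exact ⟨a, b, h1, h2, rfl⟩
    · exact ⟨b, a, h1, h2, Sym2.eq_swap⟩

theorem mem_cut_singleton {v : V} {e : Sym2 V} :
    e ∈ cut G {v} ↔ e ∈ G.edgeSet ∧ v ∈ e := by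
  induction e with
  | h a b =>
    rw [mk_mem_cut, SimpleGraph.mem_edgeSet]
    refine and_congr_right fun h => ?_
    have := h.ne
    simp only [Finset.mem_singleton, Sym2.mem_iff]
    constructor
    · rintro (⟨h1, -⟩ | ⟨h1, -⟩)
      · exact Or.inl h1.symm
      · exact Or.inr h1.symm
    · rintro (rfl | rfl)
      · exact Or.inl ⟨rfl, this.symm⟩
      · exact Or.inr ⟨rfl, this⟩

theorem mem_edgeSet_of_mem_cut {S : Finset V} {e : Sym2 V} (h : e ∈ cut G S) :
    e ∈ G.edgeSet :=
  (mem_cut.1 h).1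

open Classical in
/-- The edges of `G` with both endpoints in `T`. -/
noncomputable def inner (G : SimpleGraph V) (T : Finset V) : Finset (Sym2 V) :=
  {e | e ∈ G.edgeSet ∧ ∀ v ∈ e, v ∈ T}

theorem mem_inner {T : Finset V} {e : Sym2 V} :
    e ∈ inner G T ↔ e ∈ G.edgeSet ∧ ∀ v ∈ e, v ∈ T := by
  simp [inner]

/-- The handshake identity. -/
theorem sum_sum_cut_singleton {R : Type*} [CommSemiring R] (y : Sym2 V → R) (T : Finset V) :
    ∑ v ∈ T, ∑ e ∈ cut G {v}, y e = ∑ e ∈ cut G T, y e + 2 * ∑ e ∈ inner G T, y e := by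
  classical
  have key : ∀ A : Finset (Sym2 V), ∑ e ∈ A, y e = ∑ e, if e ∈ A then y e else 0 := by
    intro A
    rw [Finset.sum_ite_mem, Finset.univ_inter]
  simp_rw [key]
  rw [Finset.sum_comm, Finset.mul_sum, ← Finset.sum_add_distrib]
  refine Finset.sum_congr rfl fun e _ => ?_
  by_cases he : e ∈ G.edgeSet
  · induction e with
    | h a b =>
      have hne : a ≠ b := (SimpleGraph.mem_edgeSet _ |>.1 he).ne
      have h1 : ∀ v, (if s(a, b) ∈ cut G {v} then y s(a, b) else 0)
          = (if v = a then y s(a, b) else 0) + (if v = b then y s(a, b) else 0) := by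
        intro v
        have : s(a, b) ∈ cut G {v} ↔ (v = a ∨ v = b) := by
          rw [mem_cut_singleton, Sym2.mem_iff]; exact and_iff_right he
        by_cases ha : v = a
        · subst ha; simp [this, hne]
        · simp [this, ha]
      simp_rw [h1]
      rw [Finset.sum_add_distrib, Finset.sum_ite_eq', Finset.sum_ite_eq']
      have h2 : s(a, b) ∈ cut G T ↔ (a ∈ T ∧ b ∉ T ∨ b ∈ T ∧ a ∉ T) := by
        rw [mk_mem_cut]; exact and_iff_right he
      have h3 : s(a, b) ∈ inner G T ↔ (a ∈ T ∧ b ∈ T) := by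
        rw [mem_inner]; simp only [he, true_and, Sym2.mem_iff]
        constructor
        · intro h; exact ⟨h a (Or.inl rfl), h b (Or.inr rfl)⟩
        · rintro ⟨h, h'⟩ v (rfl | rfl) <;> assumption
      by_cases ha : a ∈ T <;> by_cases hb : b ∈ T <;> simp [h2, h3, ha, hb, two_mul]
  · have h1 : ∀ S, e ∉ cut G S := fun S h => he (mem_edgeSet_of_mem_cut h)
    have h2 : e ∉ inner G T := fun h => he (mem_inner.1 h).1
    simp [h1, h2]

theorem sum_cut_eq_sum_sum {R : Type*} [CommSemiring R] {y : Sym2 V → R} {T : Finset V}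
    (h : ∀ e ∈ inner G T, y e = 0) :
    ∑ e ∈ cut G T, y e = ∑ v ∈ T, ∑ e ∈ cut G {v}, y e := by
  rw [sum_sum_cut_singleton, Finset.sum_eq_zero h, mul_zero, add_zero]

/-- `M` is a set of edges of `G` forming a matching that covers precisely `U`. -/
def IsMatchingOn (G : SimpleGraph V) (M : Finset (Sym2 V)) (U : Finset V) : Prop :=
  (∀ e ∈ M, e ∈ G.edgeSet) ∧ ∀ v, (M ∩ cut G {v}).card = if v ∈ U then 1 else 0

theorem card_inter_eq_sum {A M : Finset (Sym2 V)} :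
    (M ∩ A).card = ∑ e ∈ A, if e ∈ M then 1 else 0 := by
  rw [Finset.sum_ite_mem, Finset.inter_comm]; simp

namespace IsMatchingOn

variable {M : Finset (Sym2 V)} {U : Finset V}

theorem mem_of_mem (h : IsMatchingOn G M U) {e : Sym2 V} (he : e ∈ M) {v : V} (hv : v ∈ e) :
    v ∈ U := by
  by_contra hU
  have h1 := h.2 v
  rw [if_neg hU, Finset.card_eq_zero] at h1
  have : e ∈ M ∩ cut G {v} :=
    Finset.mem_inter.2 ⟨he, mem_cut_singleton.2 ⟨h.1 e he, hv⟩⟩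
  simp [h1] at this

theorem exists_mem (h : IsMatchingOn G M U) {v : V} (hv : v ∈ U) :
    ∃ w, s(v, w) ∈ M := by
  have h1 := h.2 v
  rw [if_pos hv] at h1
  obtain ⟨e, he⟩ := Finset.card_pos.1 (h1 ▸ Nat.one_pos)
  rw [Finset.mem_inter, mem_cut_singleton] at he
  obtain ⟨w, rfl⟩ := he.2.2
  exact ⟨w, he.1⟩

theorem unique (h : IsMatchingOn G M U) {v w w' : V} (hw : s(v, w) ∈ M) (hw' : s(v, w') ∈ M) :
    w = w' := by
  have h1 : (M ∩ cut G {v}).card ≤ 1 := by rw [h.2]; split_ifs <;> simp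
  have h2 : ∀ w, s(v, w) ∈ M → s(v, w) ∈ M ∩ cut G {v} := fun w hw =>
    Finset.mem_inter.2 ⟨hw, mem_cut_singleton.2 ⟨h.1 _ hw, Sym2.mem_mk_left _ _⟩⟩
  exact Sym2.congr_right.1 (Finset.card_le_one.1 h1 _ (h2 w hw) _ (h2 w' hw'))

/-- The handshake identity for the indicator of `M`. It is the source of the parity arguments below:
the number of crossing edges has the parity of `U ∩ T`. -/
theorem card_inter_eq (h : IsMatchingOn G M U) (T : Finset V) :
    (U ∩ T).card = (M ∩ cut G T).card + 2 * (M ∩ inner G T).card := by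
  have := sum_sum_cut_singleton (G := G) (fun e => if e ∈ M then 1 else 0) T
  simp_rw [← card_inter_eq_sum, h.2] at this
  rw [← this, Finset.sum_ite_mem, Finset.inter_comm]; simp

theorem inter_cut_eq_empty (h : IsMatchingOn G M U) {T : Finset V}
    (hT : U ⊆ T ∨ Disjoint U T) : M ∩ cut G T = ∅ := by
  rw [Finset.eq_empty_iff_forall_notMem]
  intro e he
  rw [Finset.mem_inter, mem_cut] at he
  obtain ⟨heM, -, u, v, hu, hv, rfl⟩ := he
  rcases hT with hT | hT
  · exact hv (hT (h.mem_of_mem heM (Sym2.mem_mk_right _ _)))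
  · exact Finset.disjoint_left.1 hT (h.mem_of_mem heM (Sym2.mem_mk_left _ _)) hu

theorem even_card_of_inter_cut (h : IsMatchingOn G M U) {T : Finset V}
    (hT : M ∩ cut G T = ∅) : Even (U ∩ T).card := by
  rw [h.card_inter_eq T, hT]; simp

theorem even_card (h : IsMatchingOn G M U) : Even U.card := by
  have := h.even_card_of_inter_cut (h.inter_cut_eq_empty (T := U) (Or.inl subset_rfl))
  rwa [Finset.inter_self] at this

end IsMatchingOn

theorem isMatchingOn_empty : IsMatchingOn G ∅ ∅ := ⟨by simp, by simp⟩

theorem IsMatchingOn.insert {M : Finset (Sym2 V)} {U : Finset V} (h : IsMatchingOn G M U)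
    {a b : V} (hab : G.Adj a b) (ha : a ∉ U) (hb : b ∉ U) :
    IsMatchingOn G (Insert.insert s(a, b) M) (Insert.insert a (Insert.insert b U)) := by
  refine ⟨?_, fun v => ?_⟩
  · intro e he
    rcases Finset.mem_insert.1 he with rfl | he
    · exact hab
    · exact h.1 e he
  · have hv := h.2 v
    by_cases hvab : v ∈ s(a, b)
    · have hmem : s(a, b) ∈ cut G {v} := mem_cut_singleton.2 ⟨hab, hvab⟩
      have hvU : v ∉ U := by
        rcases Sym2.mem_iff.1 hvab with rfl | rfl <;> assumption
      rw [if_neg hvU, Finset.card_eq_zero] at hv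
      rw [Finset.insert_inter_of_mem hmem, hv, if_pos]
      · simp
      · rcases Sym2.mem_iff.1 hvab with rfl | rfl <;> simp
    · have hmem : s(a, b) ∉ cut G {v} := fun h => hvab (mem_cut_singleton.1 h).2
      rw [Finset.insert_inter_of_notMem hmem, hv]
      rw [Sym2.mem_iff, not_or] at hvab
      simp [hvab]

theorem mem_tightGraph_edgeSet {c : Sym2 V → ℝ} {F : Finset (Finset V)} {P : Finset V → ℝ}
    {e : Sym2 V} :
    e ∈ (tightGraph G c F P).edgeSet ↔ e ∈ G.edgeSet ∧ dualLoad G F P e = c e := by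
  rw [tightGraph, SimpleGraph.edgeSet_fromEdgeSet, Set.mem_sdiff]
  refine and_iff_left_of_imp fun h hd => ?_
  exact G.not_isDiag_of_mem_edgeSet h.1 hd

/-- Factor-criticality in terms of edge sets. -/
theorem isFactorCritical_iff {H : SimpleGraph V} (hHG : H ≤ G) {F : Finset (Finset V)}
    {S : Finset V} :
    IsFactorCritical H F S ↔ ∀ u ∈ S, ∃ M : Finset (Sym2 V), (∀ e ∈ M, e ∈ H.edgeSet) ∧
      IsMatchingOn G M (S \ {u}) ∧ ∀ T ∈ F, (M ∩ cut G T).card ≤ 1 := by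
  classical
  refine forall₂_congr fun u _ => ?_
  have hcut : ∀ (M : Finset (Sym2 V)) (T : Finset V), (∀ e ∈ M, e ∈ H.edgeSet) →
      ((M : Set (Sym2 V)) ∩ (cut H T : Set (Sym2 V))) = ((M ∩ cut G T : Finset _) : Set _) := by
    intro M T hM
    ext e
    simp only [Set.mem_inter_iff, Finset.mem_coe, Finset.mem_inter, mem_cut]
    refine and_congr_right fun he => and_congr_left fun _ => ?_
    exact iff_of_true (hM e he) (SimpleGraph.edgeSet_mono hHG (hM e he))
  constructor
  · rintro ⟨M, hM, hv, hF⟩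
    have hsub : ∀ e ∈ M.edgeSet.toFinset, e ∈ H.edgeSet := fun e he =>
      M.edgeSet_subset (by simpa using he)
    refine ⟨M.edgeSet.toFinset, hsub, ⟨fun e he => SimpleGraph.edgeSet_mono hHG (hsub e he), ?_⟩,
      fun T hT => ?_⟩
    · intro v
      split_ifs with h
      · obtain ⟨w, hw, huniq⟩ := hM (show v ∈ M.verts by rw [hv]; exact h)
        rw [Finset.card_eq_one]
        refine ⟨s(v, w), ?_⟩
        ext e
        simp only [Finset.mem_inter, Set.mem_toFinset, mem_cut_singleton, Finset.mem_singleton]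
        constructor
        · rintro ⟨he, -, w', rfl⟩
          rw [huniq w' he]
        · rintro rfl
          exact ⟨hw, hHG (M.adj_sub hw), Sym2.mem_mk_left _ _⟩
      · rw [Finset.card_eq_zero, Finset.eq_empty_iff_forall_notMem]
        intro e he
        simp only [Finset.mem_inter, Set.mem_toFinset, mem_cut_singleton] at he
        obtain ⟨he, -, w', rfl⟩ := he
        apply h
        have : v ∈ M.verts := M.edge_vert he
        rw [hv] at this
        exact this
    · have := hF T hT
      rw [← Set.ncard_coe_finset, ← hcut _ _ hsub, Set.coe_toFinset]
      exact this
  · rintro ⟨M, hMH, hM, hF⟩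
    refine ⟨⟨(S \ {u} : Finset V), fun a b => s(a, b) ∈ M, fun h => hMH _ h, fun h => ?_, ?_⟩,
      ?_, rfl, ?_⟩
    · exact hM.mem_of_mem h (Sym2.mem_mk_left _ _)
    · exact ⟨fun a b h => by rwa [Sym2.eq_swap]⟩
    · intro v hv
      obtain ⟨w, hw⟩ := hM.exists_mem hv
      exact ⟨w, hw, fun w' hw' => hM.unique hw' hw⟩
    · intro T hT
      have := hF T hT
      rw [← Set.ncard_coe_finset, ← hcut _ _ hMH] at this
      convert this using 3
      ext e
      induction e with
      | h a b => exact Iff.rfl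

end Basics

/-! ### The extremal dual agrees with `Γ` inside its positive sets -/

section Dual

set_option linter.unusedSectionVars false

variable {V : Type*} [Fintype V] [DecidableEq V] {G : SimpleGraph V} {c : Sym2 V → ℝ}
  {F : Finset (Finset V)}

theorem mem_singletons {S : Finset V} : S ∈ singletons V ↔ ∃ v, {v} = S := by
  simp [singletons]

theorem singleton_mem (F : Finset (Finset V)) (v : V) : {v} ∈ singletons V ∪ F :=
  Finset.mem_union_left _ (mem_singletons.2 ⟨v, rfl⟩)

theorem IsOddFamily.nonempty (hF : IsOddFamily F) {S : Finset V} (hS : S ∈ singletons V ∪ F) :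
    S.Nonempty := by
  rcases Finset.mem_union.1 hS with h | h
  · obtain ⟨v, rfl⟩ := mem_singletons.1 h
    simp
  · have := (hF S h).2
    exact Finset.card_pos.1 (by omega)

theorem IsOddFamily.odd_card (hF : IsOddFamily F) {S : Finset V}
    (hS : S ∈ singletons V ∪ F) : Odd S.card := by
  rcases Finset.mem_union.1 hS with h | h
  · obtain ⟨v, rfl⟩ := mem_singletons.1 h
    simp
  · exact (hF S h).1

theorem disjoint_or_subset_singleton (v : V) (T : Finset V) :
    Disjoint {v} T ∨ {v} ⊆ T := by
  by_cases h : v ∈ T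
  · exact Or.inr (Finset.singleton_subset_iff.2 h)
  · exact Or.inl (Finset.disjoint_singleton_left.2 h)

theorem IsLaminar.union_singletons (hF : IsLaminar F) : IsLaminar (singletons V ∪ F) := by
  intro X hX Y hY
  rcases Finset.mem_union.1 hX with h | h
  · obtain ⟨v, rfl⟩ := mem_singletons.1 h
    rcases disjoint_or_subset_singleton v Y with h | h
    · exact Or.inl h
    · exact Or.inr (Or.inl h)
  · rcases Finset.mem_union.1 hY with h' | h'
    · obtain ⟨v, rfl⟩ := mem_singletons.1 h'
      rcases disjoint_or_subset_singleton v X with h | h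
      · exact Or.inl h.symm
      · exact Or.inr (Or.inr h)
    · exact hF X h Y h'

theorem dualLoad_eq_sum_ite (P : Finset V → ℝ) (e : Sym2 V) :
    dualLoad G F P e = ∑ T ∈ singletons V ∪ F, if e ∈ cut G T then P T else 0 := by
  rw [dualLoad, Finset.sum_filter]

theorem sum_dualLoad_mul (P : Finset V → ℝ) (y : Sym2 V → ℝ) :
    ∑ e, dualLoad G F P e * y e =
      ∑ T ∈ singletons V ∪ F, P T * ∑ e ∈ cut G T, y e := by
  simp_rw [dualLoad_eq_sum_ite, Finset.sum_mul]
  rw [Finset.sum_comm]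
  refine Finset.sum_congr rfl fun T _ => ?_
  rw [Finset.mul_sum]
  simp_rw [ite_mul, zero_mul]
  rw [Finset.sum_ite_mem, Finset.univ_inter]

theorem sum_dualLoad (P : Finset V → ℝ) (M : Finset (Sym2 V)) :
    ∑ e ∈ M, dualLoad G F P e =
      ∑ T ∈ singletons V ∪ F, P T * ((M ∩ cut G T).card : ℝ) := by
  have := sum_dualLoad_mul (G := G) (F := F) P (fun e => if e ∈ M then 1 else 0)
  simp_rw [card_inter_eq_sum]
  push_cast
  rw [← this]
  simp

theorem dualLoad_add_smul (P D : Finset V → ℝ) (l : ℝ) (e : Sym2 V) :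
    dualLoad G F (fun T => P T + l * D T) e = dualLoad G F P e + l * dualLoad G F D e := by
  simp only [dualLoad, Finset.sum_add_distrib, Finset.mul_sum]

/-- An edge inside `S` is only loaded by the proper subsets of `S`. -/
theorem ssubset_of_mem_cut (hF : IsLaminar F) {S T : Finset V} (hS : S ∈ singletons V ∪ F)
    (hT : T ∈ singletons V ∪ F) {e : Sym2 V} (heS : ∀ v ∈ e, v ∈ S) (he : e ∈ cut G T) :
    T ⊂ S := by
  obtain ⟨-, u, v, hu, hv, rfl⟩ := mem_cut.1 he
  have huS := heS u (Sym2.mem_mk_left _ _)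
  have hvS := heS v (Sym2.mem_mk_right _ _)
  rcases hF.union_singletons T hT S hS with h | h | h
  · exact absurd huS (Finset.disjoint_left.1 h hu)
  · exact (Finset.ssubset_iff_of_subset h).2 ⟨v, hvS, hv⟩
  · exact absurd (h hvS) hv

theorem dualLoad_congr_of_inside (hF : IsLaminar F) {S : Finset V}
    (hS : S ∈ singletons V ∪ F) {P Q : Finset V → ℝ}
    (hPQ : ∀ T ∈ singletons V ∪ F, T ⊂ S → P T = Q T) {e : Sym2 V} (heS : ∀ v ∈ e, v ∈ S) :
    dualLoad G F P e = dualLoad G F Q e := by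
  refine Finset.sum_congr rfl fun T hT => ?_
  rw [Finset.mem_filter] at hT
  exact hPQ T hT.1 (ssubset_of_mem_cut hF hS hT.1 heS hT.2)

/-- How a near-perfect matching of `S` crosses the members of the family. -/
theorem card_inter_cut_eq (hodd : IsOddFamily F) (hlam : IsLaminar F) {S : Finset V}
    (hS : S ∈ singletons V ∪ F) {u : V} {M : Finset (Sym2 V)}
    (hM : IsMatchingOn G M (S \ {u})) (hMF : ∀ T ∈ F, (M ∩ cut G T).card ≤ 1)
    {T : Finset V} (hT : T ∈ singletons V ∪ F) :
    (M ∩ cut G T).card = if T ⊆ S ∧ u ∉ T then 1 else 0 := by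
  have hle : (M ∩ cut G T).card ≤ 1 := by
    rcases Finset.mem_union.1 hT with h | h
    · obtain ⟨v, rfl⟩ := mem_singletons.1 h
      rw [hM.2]; split_ifs <;> simp
    · exact hMF T h
  have hzero : (S \ {u} ⊆ T ∨ Disjoint (S \ {u}) T) → (M ∩ cut G T).card = 0 := fun h =>
    Finset.card_eq_zero.2 (hM.inter_cut_eq_empty h)
  by_cases hTS : T ⊆ S
  · have hpar := hM.card_inter_eq T
    have hTodd := hodd.odd_card hT
    have h1 : S \ {u} ∩ T = T.erase u := by
      ext v
      simp only [Finset.mem_inter, Finset.mem_sdiff, Finset.mem_singleton, Finset.mem_erase]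
      exact ⟨fun h => ⟨h.1.2, h.2⟩, fun h => ⟨⟨hTS h.2, h.1⟩, h.2⟩⟩
    rw [h1] at hpar
    by_cases huT : u ∈ T
    · rw [Finset.card_erase_of_mem huT] at hpar
      rw [if_neg (by tauto)]
      obtain ⟨k, hk⟩ := hTodd
      omega
    · rw [Finset.erase_eq_of_notMem huT] at hpar
      rw [if_pos ⟨hTS, huT⟩]
      obtain ⟨k, hk⟩ := hTodd
      omega
  · rw [if_neg (by tauto)]
    apply hzero
    rcases hlam.union_singletons T hT S hS with h | h | h
    · exact Or.inr (h.symm.mono_left Finset.sdiff_subset)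
    · exact absurd h hTS
    · exact Or.inl (Finset.sdiff_subset.trans h)

theorem tightGraph_le {P : Finset V → ℝ} : tightGraph G c F P ≤ G := by
  rw [← SimpleGraph.edgeSet_subset_edgeSet]
  exact fun e he => (mem_tightGraph_edgeSet.1 he).1

/-- Near-perfect matchings of tight edges in the members of a critical family. -/
theorem IsCriticalDual.exists_matching {Γ : Finset V → ℝ} (hΓ : IsCriticalDual G c F Γ)
    {S : Finset V} (hS : S ∈ singletons V ∪ F) {u : V} (hu : u ∈ S) :
    ∃ M : Finset (Sym2 V), (∀ e ∈ M, dualLoad G F Γ e = c e) ∧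
      IsMatchingOn G M (S \ {u}) ∧ ∀ T ∈ F, (M ∩ cut G T).card ≤ 1 := by
  rcases Finset.mem_union.1 hS with h | h
  · obtain ⟨v, rfl⟩ := mem_singletons.1 h
    obtain rfl := Finset.mem_singleton.1 hu
    exact ⟨∅, by simp, by simpa using isMatchingOn_empty, by simp⟩
  · obtain ⟨M, h1, h2, h3⟩ := (isFactorCritical_iff tightGraph_le).1 (hΓ.factorCritical S h) u hu
    exact ⟨M, fun e he => (mem_tightGraph_edgeSet.1 (h1 e he)).2, h2, h3⟩

/-- An extremal dual agrees with `Γ` strictly inside every set on which it is positive. -/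
theorem IsExtremalDual.eq_of_ssubset {Γ P : Finset V → ℝ} (hF : IsCriticalFamily G c F)
    (hΓ : IsCriticalDual G c F Γ) (hP : IsExtremalDual G c F Γ P) {S : Finset V} (hS : S ∈ F)
    (hPS : 0 < P S) {T : Finset V} (hT : T ∈ singletons V ∪ F) (hTS : T ⊂ S) :
    P T = Γ T := by
  classical
  have hS' : S ∈ singletons V ∪ F := Finset.mem_union_right _ hS
  -- `D` points from `P` to `Γ` strictly inside `S`; the value `K` at `S` makes its total zero.
  set K : ℝ := ∑ T ∈ singletons V ∪ F, if T ⊂ S then P T - Γ T else 0 with hK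
  set D : Finset V → ℝ := fun T => if T ⊂ S then Γ T - P T else if T = S then K else 0 with hD
  have hD1 : ∀ T, T ⊂ S → D T = Γ T - P T := fun T h => by simp only [hD, if_pos h]
  have hD2 : D S = K := by simp [hD]
  have hD3 : ∀ T, ¬ T ⊆ S → D T = 0 := fun T h => by
    have h1 : ¬ T ⊂ S := fun h' => h h'.1
    have h2 : T ≠ S := fun h' => h (h' ▸ subset_rfl)
    simp only [hD, if_neg h1, if_neg h2]
  have hDsum : ∑ T ∈ singletons V ∪ F, D T = 0 := by
    have : ∀ T, D T = (if T = S then K else 0) - (if T ⊂ S then P T - Γ T else 0) := by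
      intro T
      by_cases h1 : T ⊂ S
      · simp [hD, h1, h1.ne]
      · simp [hD, h1]
    simp_rw [this]
    rw [Finset.sum_sub_distrib, Finset.sum_ite_eq', if_pos hS', ← hK, sub_self]
  have hload : ∀ e ∈ G.edgeSet, dualLoad G F D e ≤ c e - dualLoad G F P e ∧
      0 ≤ c e - dualLoad G F P e := by
    intro e he
    have hnn : 0 ≤ c e - dualLoad G F P e := sub_nonneg.2 (hP.1.1.edge e he)
    refine ⟨?_, hnn⟩
    have hcross : ∀ a b, a ∈ S → b ∉ S → e = s(a, b) → dualLoad G F D e ≤ 0 := by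
      rintro a b ha hb rfl
      obtain ⟨M, hM1, hM2, hM3⟩ := hΓ.exists_matching hS' ha
      -- The edges of `M` are tight for `Γ`, so the load of `D` on each is exactly the slack of `P`
      -- there.
      have h1 : 0 ≤ ∑ f ∈ M, dualLoad G F D f := by
        refine Finset.sum_nonneg fun f hf => ?_
        have hfS : ∀ v ∈ f, v ∈ S := fun v hv =>
          (Finset.mem_sdiff.1 (hM2.mem_of_mem hf hv)).1
        have : dualLoad G F D f = dualLoad G F (fun T => Γ T + (-1) * P T) f :=
          dualLoad_congr_of_inside hF.laminar hS' (fun T _ h => by rw [hD1 T h]; ring) hfS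
        rw [this, dualLoad_add_smul, hM1 f hf]
        linarith [hP.1.1.edge f (hM2.1 f hf)]
      rw [sum_dualLoad] at h1
      -- A set `T ⊆ S` either contains `a` and is crossed by the edge `s(a, b)` alone, or misses `a`
      -- and is crossed once by `M`. The two loads together thus give the total of `D`, which is
      -- zero.
      have h2 : dualLoad G F D s(a, b) = ∑ T ∈ singletons V ∪ F, D T -
          ∑ T ∈ singletons V ∪ F, D T * ((M ∩ cut G T).card : ℝ) := by
        rw [dualLoad_eq_sum_ite, ← Finset.sum_sub_distrib]
        refine Finset.sum_congr rfl fun T hT => ?_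
        rw [card_inter_cut_eq hF.odd hF.laminar hS' hM2 hM3 hT]
        by_cases hTS : T ⊆ S
        · have hbT : b ∉ T := fun h => hb (hTS h)
          have : s(a, b) ∈ cut G T ↔ a ∈ T := by
            rw [mk_mem_cut]
            simp only [(SimpleGraph.mem_edgeSet _).1 he, true_and, hbT, not_false_eq_true,
              and_true, false_and, or_false]
          by_cases haT : a ∈ T <;> simp [this, haT, hTS]
        · simp [hD3 T hTS]
      rw [h2, hDsum]
      linarith
    induction e with
    | h a b =>
      by_cases ha : a ∈ S <;> by_cases hb : b ∈ S
      · have hin : ∀ v ∈ s(a, b), v ∈ S := by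
          intro v hv
          rcases Sym2.mem_iff.1 hv with rfl | rfl <;> assumption
        have : dualLoad G F D s(a, b) = dualLoad G F (fun T => Γ T + (-1) * P T) s(a, b) :=
          dualLoad_congr_of_inside hF.laminar hS' (fun T _ h => by rw [hD1 T h]; ring) hin
        rw [this, dualLoad_add_smul]
        linarith [hΓ.feasible.edge _ he]
      · exact (hcross a b ha hb rfl).trans hnn
      · exact (hcross b a hb ha Sym2.eq_swap).trans hnn
      · have : dualLoad G F D s(a, b) = 0 := by
          refine Finset.sum_eq_zero fun T hT => hD3 T fun hTS => ?_
          rw [Finset.mem_filter, mk_mem_cut] at hT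
          rcases hT.2.2 with h | h
          · exact ha (hTS h.1)
          · exact hb (hTS h.1)
        rw [this]; exact hnn
  -- The positivity of `P S` is what leaves room for a step; `|K| + 1` avoids division by zero.
  obtain ⟨l, hl0, hl1, hlK⟩ : ∃ l : ℝ, 0 < l ∧ l ≤ 1 ∧ l * |K| ≤ P S := by
    refine ⟨min 1 (P S / (|K| + 1)), lt_min one_pos (by positivity), min_le_left _ _, ?_⟩
    calc min 1 (P S / (|K| + 1)) * |K| ≤ P S / (|K| + 1) * (|K| + 1) := by
          gcongr
          · exact min_le_right _ _
          · linarith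
      _ = P S := by field_simp
  set Q : Finset V → ℝ := fun T => P T + l * D T with hQ
  have hQfeas : IsDualFeasible G c F Q := by
    refine ⟨fun T hT => ?_, fun e he => ?_, fun T hT => ?_⟩
    · have h1 := hP.1.1.eq_zero T hT
      have h2 := hΓ.feasible.eq_zero T hT
      have h3 : T ≠ S := fun h => hT (h ▸ hS')
      simp [hQ, hD, h1, h2, h3]
    · rw [hQ, dualLoad_add_smul]
      obtain ⟨h1, h2⟩ := hload e he
      nlinarith
    · have h1 := hP.1.1.nonneg T hT
      have h2 := hΓ.feasible.nonneg T hT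
      by_cases hTS : T ⊂ S
      · simp only [hQ, hD1 T hTS]
        nlinarith
      · by_cases hTS' : T = S
        · subst hTS'
          simp only [hQ, hD2]
          nlinarith [neg_abs_le K]
        · have : D T = 0 := by simp only [hD, if_neg hTS, if_neg hTS']
          simp only [hQ, this]; linarith
  have hQopt : IsDualOptimal G c F Q := by
    refine ⟨hQfeas, fun R hR => (hP.1.2 R hR).trans_eq ?_⟩
    simp only [dualValue, hQ]
    rw [Finset.sum_add_distrib, ← Finset.mul_sum, hDsum, mul_zero, add_zero]
  have hdist := hP.2 Q hQopt
  have hcardS : (0 : ℝ) < S.card := by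
    exact_mod_cast Finset.card_pos.2 (hF.odd.nonempty hS')
  have hterm : ∀ T ∈ singletons V ∪ F, |Q T - Γ T| / (T.card : ℝ) ≤
      |P T - Γ T| / (T.card : ℝ) + l * ((if T = S then |K| / (S.card : ℝ) else 0) -
        (if T ⊂ S then |P T - Γ T| / (T.card : ℝ) else 0)) := by
    intro T hT
    by_cases hTS : T ⊂ S
    · simp only [if_pos hTS, if_neg hTS.ne, hQ, hD1 T hTS]
      have : P T + l * (Γ T - P T) - Γ T = (1 - l) * (P T - Γ T) := by ring
      rw [this, abs_mul, abs_of_nonneg (sub_nonneg.2 hl1)]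
      apply le_of_eq; ring
    · by_cases hTS' : T = S
      · subst hTS'
        simp only [if_neg hTS, if_true, hQ, hD2, sub_zero]
        rw [mul_div_assoc', ← add_div]
        refine div_le_div_of_nonneg_right ?_ (Nat.cast_nonneg _)
        have : P T + l * K - Γ T = (P T - Γ T) + l * K := by ring
        rw [this]
        refine (abs_add_le _ _).trans ?_
        rw [abs_mul, abs_of_pos hl0]
      · have : D T = 0 := by simp only [hD, if_neg hTS, if_neg hTS']
        simp [hTS, hTS', hQ, this]
  have hsum := hdist.trans (Finset.sum_le_sum hterm)
  rw [Finset.sum_add_distrib, ← Finset.mul_sum, Finset.sum_sub_distrib, Finset.sum_ite_eq',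
    if_pos hS'] at hsum
  -- By extremality the gain strictly inside `S` cannot exceed the possible loss at `S`.
  have hmain : ∑ T ∈ singletons V ∪ F, (if T ⊂ S then |P T - Γ T| / (T.card : ℝ) else 0) ≤
      |K| / (S.card : ℝ) := by
    have h : 0 ≤ l * (|K| / (S.card : ℝ) -
      ∑ T ∈ singletons V ∪ F, (if T ⊂ S then |P T - Γ T| / (T.card : ℝ) else 0)) := by
      simpa [dualDist] using hsum
    have := nonneg_of_mul_nonneg_right h hl0
    linarith
  have hKle : |K| / (S.card : ℝ) ≤
      ∑ T ∈ singletons V ∪ F, (if T ⊂ S then |P T - Γ T| / (S.card : ℝ) else 0) := by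
    rw [div_le_iff₀ hcardS, Finset.sum_mul]
    refine (Finset.abs_sum_le_sum_abs _ _).trans (Finset.sum_le_sum fun T _ => ?_)
    split_ifs
    · rw [div_mul_cancel₀ _ hcardS.ne']
    · simp
  have hle : ∀ T ∈ singletons V ∪ F, (if T ⊂ S then |P T - Γ T| / (S.card : ℝ) else 0) ≤
      (if T ⊂ S then |P T - Γ T| / (T.card : ℝ) else 0) := by
    intro T hT
    split_ifs with h
    · have : (0 : ℝ) < T.card := by exact_mod_cast Finset.card_pos.2 (hF.odd.nonempty hT)
      have h2 : (T.card : ℝ) ≤ S.card := by exact_mod_cast Finset.card_le_card h.1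
      exact div_le_div_of_nonneg_left (abs_nonneg _) this h2
    · exact le_rfl
  -- The chain of inequalities closes up, so equality holds term by term; since `|T| < |S|`, the
  -- numerator must vanish.
  have heq := (Finset.sum_eq_sum_iff_of_le hle).1
    (le_antisymm (Finset.sum_le_sum hle) (hmain.trans hKle)) T hT
  simp only [if_pos hTS] at heq
  have hTpos : (0 : ℝ) < T.card := by exact_mod_cast Finset.card_pos.2 (hF.odd.nonempty hT)
  have hlt : (T.card : ℝ) < S.card := by exact_mod_cast Finset.card_lt_card hTS
  rw [div_eq_div_iff hcardS.ne' hTpos.ne'] at heq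
  have h0 : |P T - Γ T| * ((S.card : ℝ) - T.card) = 0 := by linarith
  rcases mul_eq_zero.1 h0 with h | h
  · exact sub_eq_zero.1 (abs_eq_zero.1 h)
  · linarith

/-- Edges inside `S` are loaded only by proper subsets of `S`, where `P` and `Γ` agree, so the
matchings that serve `Γ` also serve `P`. -/
theorem IsExtremalDual.isPositivelyCriticalDual {Γ P : Finset V → ℝ}
    (hF : IsCriticalFamily G c F) (hΓ : IsCriticalDual G c F Γ)
    (hP : IsExtremalDual G c F Γ P) : IsPositivelyCriticalDual G c F P := by
  refine ⟨hP.1.1, fun S hS hPS => (isFactorCritical_iff tightGraph_le).2 fun u hu => ?_⟩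
  have hS' : S ∈ singletons V ∪ F := Finset.mem_union_right _ hS
  obtain ⟨M, h1, h2, h3⟩ := hΓ.exists_matching hS' hu
  refine ⟨M, fun e he => mem_tightGraph_edgeSet.2 ⟨h2.1 e he, ?_⟩, h2, h3⟩
  rw [← h1 e he]
  exact dualLoad_congr_of_inside hF.laminar hS'
    (fun T hT hTS => hP.eq_of_ssubset hF hΓ hS hPS hT hTS)
    fun v hv => (Finset.mem_sdiff.1 (h2.mem_of_mem he hv)).1

end Dual

/-! ### Farkas' lemma by induction on the number of constraints -/

section Farkas

/-- Farkas' lemma for finitely many linear functionals on a real vector space. -/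
theorem farkas {W ι : Type*} [AddCommGroup W] [Module ℝ W] (s : Finset ι)
    (A : ι → W →ₗ[ℝ] ℝ) (b : W →ₗ[ℝ] ℝ) (h : ∀ x, (∀ i ∈ s, A i x ≤ 0) → b x ≤ 0) :
    ∃ l : ι → ℝ, (∀ i, 0 ≤ l i) ∧ b = ∑ i ∈ s, l i • A i := by
  classical
  induction s using Finset.induction_on generalizing A b with
  | empty =>
    refine ⟨0, fun _ => le_rfl, LinearMap.ext fun x => ?_⟩
    have h1 := h x (by simp)
    have h2 := h (-x) (by simp)
    simp only [map_neg] at h2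
    simp only [Finset.sum_empty, LinearMap.zero_apply]
    linarith
  | insert j s hj ih =>
    by_cases hs : ∀ x, (∀ i ∈ s, A i x ≤ 0) → b x ≤ 0
    · obtain ⟨l, hl, hb⟩ := ih A b hs
      refine ⟨fun i => if i = j then 0 else l i, fun i => ?_, ?_⟩
      · dsimp only; split_ifs
        exacts [le_rfl, hl i]
      · rw [Finset.sum_insert hj, hb]
        simp only [if_true, zero_smul, zero_add]
        exact Finset.sum_congr rfl fun i hi => by rw [if_neg (ne_of_mem_of_not_mem hi hj)]
    · push Not at hs
      obtain ⟨x₀, hx₀, hb₀⟩ := hs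
      have hj₀ : 0 < A j x₀ := by
        by_contra hcon
        refine absurd (h x₀ fun i hi => ?_) (not_le.2 hb₀)
        rcases Finset.mem_insert.1 hi with rfl | hi
        · exact not_lt.1 hcon
        · exact hx₀ i hi
      -- Normalised so that `x ↦ x - A j x • x₁` projects onto the kernel of `A j`; the induction
      -- hypothesis is applied to the functionals composed with this projection.
      set x₁ : W := (A j x₀)⁻¹ • x₀ with hx₁
      have hj₁ : A j x₁ = 1 := by simp [hx₁, hj₀.ne']
      have hA₁ : ∀ i ∈ s, A i x₁ ≤ 0 := fun i hi => by
        rw [hx₁, map_smul, smul_eq_mul]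
        exact mul_nonpos_of_nonneg_of_nonpos (inv_nonneg.2 hj₀.le) (hx₀ i hi)
      have hb₁ : 0 < b x₁ := by
        rw [hx₁, map_smul, smul_eq_mul]
        positivity
      obtain ⟨l, hl, hb⟩ := ih (fun i => A i - A i x₁ • A j) (b - b x₁ • A j) (by
        intro x hx
        have hy := h (x - A j x • x₁) (by
          intro i hi
          rcases Finset.mem_insert.1 hi with rfl | hi
          · simp [hj₁]
          · have := hx i hi
            simp only [LinearMap.sub_apply, LinearMap.smul_apply, smul_eq_mul] at this
            simp only [map_sub, map_smul, smul_eq_mul]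
            linarith)
        simp only [map_sub, map_smul, smul_eq_mul] at hy
        simp only [LinearMap.sub_apply, LinearMap.smul_apply, smul_eq_mul]
        linarith)
      -- The multiplier of `A j` is forced by evaluation at `x₁`.
      refine ⟨fun i => if i = j then b x₁ - ∑ i ∈ s, l i * A i x₁ else l i, fun i => ?_, ?_⟩
      · dsimp only; split_ifs
        · have : ∑ i ∈ s, l i * A i x₁ ≤ 0 := Finset.sum_nonpos fun i hi =>
            mul_nonpos_of_nonneg_of_nonpos (hl i) (hA₁ i hi)
          linarith
        · exact hl i
      · rw [Finset.sum_insert hj]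
        have h1 : ∑ i ∈ s, (if i = j then b x₁ - ∑ i ∈ s, l i * A i x₁ else l i) • A i =
            ∑ i ∈ s, l i • A i :=
          Finset.sum_congr rfl fun i hi => by rw [if_neg (ne_of_mem_of_not_mem hi hj)]
        rw [h1]
        ext x
        have h2 := LinearMap.congr_fun hb x
        simp only [LinearMap.sub_apply, LinearMap.smul_apply, smul_eq_mul,
          LinearMap.coe_sum, Finset.sum_apply, mul_sub, Finset.sum_sub_distrib] at h2
        simp only [LinearMap.add_apply, LinearMap.smul_apply, smul_eq_mul, if_true,
          LinearMap.coe_sum, Finset.sum_apply]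
        have h3 : ∑ i ∈ s, l i * (A i x₁ * A j x) = (∑ i ∈ s, l i * A i x₁) * A j x := by
          rw [Finset.sum_mul]; exact Finset.sum_congr rfl fun i _ => by ring
        rw [h3] at h2
        linarith

end Farkas

/-! ### Linear programming duality and complementary slackness -/

section Duality

set_option linter.unusedSectionVars false

variable {V : Type*} [Fintype V] [DecidableEq V] {G : SimpleGraph V} {c : Sym2 V → ℝ}
  {F : Finset (Finset V)}

theorem primalCost_eq {x : Sym2 V → ℝ} (hx : ∀ e, e ∉ G.edgeSet → x e = 0) :
    primalCost G c x = ∑ e, c e * x e := by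
  classical
  rw [primalCost, Finset.sum_filter]
  refine Finset.sum_congr rfl fun e _ => ?_
  split_ifs with h
  · rfl
  · rw [hx e h, mul_zero]

/-- The cost as reduced cost plus the dual contribution of the cuts. -/
theorem primalCost_eq_add (P : Finset V → ℝ) {x : Sym2 V → ℝ}
    (hx : ∀ e, e ∉ G.edgeSet → x e = 0) :
    primalCost G c x = ∑ e, (c e - dualLoad G F P e) * x e +
      ∑ T ∈ singletons V ∪ F, P T * ∑ e ∈ cut G T, x e := by
  rw [primalCost_eq hx, ← sum_dualLoad_mul, ← Finset.sum_add_distrib]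
  exact Finset.sum_congr rfl fun e _ => by ring

theorem reducedCost_mul_nonneg {P : Finset V → ℝ} (hP : IsDualFeasible G c F P)
    {x : Sym2 V → ℝ} (hx : IsPrimalFeasible G F x) (e : Sym2 V) :
    0 ≤ (c e - dualLoad G F P e) * x e := by
  by_cases he : e ∈ G.edgeSet
  · exact mul_nonneg (sub_nonneg.2 (hP.edge e he)) (hx.nonneg e)
  · rw [hx.eq_zero e he, mul_zero]

theorem weak_duality {P : Finset V → ℝ} (hP : IsDualFeasible G c F P)
    {x : Sym2 V → ℝ} (hx : IsPrimalFeasible G F x) : dualValue F P ≤ primalCost G c x := by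
  rw [primalCost_eq_add (F := F) P hx.eq_zero]
  refine le_trans ?_ (le_add_of_nonneg_left
    (Finset.sum_nonneg fun e _ => reducedCost_mul_nonneg hP hx e))
  refine Finset.sum_le_sum fun T hT => ?_
  rcases Finset.mem_union.1 hT with h | h
  · obtain ⟨v, rfl⟩ := mem_singletons.1 h
    rw [hx.degree, mul_one]
  · exact le_mul_of_one_le_right (hP.nonneg T h) (hx.blossom T h)

/-- An optimal dual solution has a complementary primal solution. -/
theorem IsDualOptimal.exists_complementary {P : Finset V → ℝ} (hP : IsDualOptimal G c F P)
    (hF : IsOddFamily F) :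
    ∃ x, IsPrimalFeasible G F x ∧ (∀ e, 0 < x e → dualLoad G F P e = c e) ∧
      ∀ S ∈ F, 0 < P S → ∑ e ∈ cut G S, x e = 1 := by
  classical
  let ev : Finset V → ((Finset V → ℝ) →ₗ[ℝ] ℝ) := fun T => LinearMap.proj T
  -- Only the constraints active at `P` enter, the others being replaced by zero; complementary
  -- slackness is then built into the multipliers.
  let A : Sym2 V ⊕ Finset V → ((Finset V → ℝ) →ₗ[ℝ] ℝ) := Sum.elim
    (fun e => if e ∈ G.edgeSet ∧ dualLoad G F P e = c e then
      ∑ T ∈ singletons V ∪ F with e ∈ cut G T, ev T else 0)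
    (fun S => if S ∈ F ∧ P S = 0 then - ev S else 0)
  have hA1 : ∀ e D, e ∈ G.edgeSet → dualLoad G F P e = c e →
      A (Sum.inl e) D = dualLoad G F D e := by
    intro e D h1 h2
    simp only [A, Sum.elim_inl, if_pos (And.intro h1 h2)]
    simp only [LinearMap.coe_sum, Finset.sum_apply, ev, LinearMap.proj_apply, dualLoad]
  have hA2 : ∀ S D, S ∈ F → P S = 0 → A (Sum.inr S) D = - D S := by
    intro S D h1 h2
    simp only [A, Sum.elim_inr, if_pos (And.intro h1 h2), LinearMap.neg_apply, ev,
      LinearMap.proj_apply]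
  obtain ⟨l, hl, hb⟩ := farkas Finset.univ A (∑ T ∈ singletons V ∪ F, ev T) (by
    intro D hD
    by_contra hcon
    push Not at hcon
    simp only [LinearMap.coe_sum, Finset.sum_apply, ev, LinearMap.proj_apply] at hcon
    have hedge : ∀ e, ∀ᶠ t : ℝ in nhdsWithin 0 (Set.Ioi 0), e ∈ G.edgeSet →
        dualLoad G F P e + t * dualLoad G F D e ≤ c e := by
      intro e
      by_cases he : e ∈ G.edgeSet
      · rcases (hP.1.edge e he).lt_or_eq with hlt | heq
        · have : Filter.Tendsto (fun t : ℝ => dualLoad G F P e + t * dualLoad G F D e)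
              (nhdsWithin 0 (Set.Ioi 0)) (nhds (dualLoad G F P e + 0 * dualLoad G F D e)) :=
            (Continuous.tendsto (by fun_prop) 0).mono_left nhdsWithin_le_nhds
          rw [zero_mul, add_zero] at this
          exact (this.eventually (eventually_lt_nhds hlt)).mono fun t ht _ => ht.le
        · have h1 := hD (Sum.inl e) (Finset.mem_univ _)
          rw [hA1 e D he heq] at h1
          filter_upwards [self_mem_nhdsWithin] with t ht _
          rw [heq]
          nlinarith [Set.mem_Ioi.1 ht]
      · exact Filter.Eventually.of_forall fun t h => absurd h he
    have hnn : ∀ S, ∀ᶠ t : ℝ in nhdsWithin 0 (Set.Ioi 0), S ∈ F → 0 ≤ P S + t * D S := by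
      intro S
      by_cases hS : S ∈ F
      · rcases (hP.1.nonneg S hS).lt_or_eq with hlt | heq
        · have : Filter.Tendsto (fun t : ℝ => P S + t * D S)
              (nhdsWithin 0 (Set.Ioi 0)) (nhds (P S + 0 * D S)) :=
            (Continuous.tendsto (by fun_prop) 0).mono_left nhdsWithin_le_nhds
          rw [zero_mul, add_zero] at this
          exact (this.eventually (eventually_gt_nhds hlt)).mono fun t ht _ => ht.le
        · have h1 := hD (Sum.inr S) (Finset.mem_univ _)
          rw [hA2 S D hS heq.symm] at h1
          filter_upwards [self_mem_nhdsWithin] with t ht _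
          rw [← heq, zero_add]
          exact mul_nonneg (Set.mem_Ioi.1 ht).le (by linarith)
      · exact Filter.Eventually.of_forall fun t h => absurd h hS
    obtain ⟨t, ht1, ht2, ht0⟩ := ((Filter.eventually_all.2 hedge).and
      ((Filter.eventually_all.2 hnn).and self_mem_nhdsWithin)).exists
    have ht0 : 0 < t := ht0
    -- A direction `D` increasing the objective while respecting the active constraints would give
    -- this better feasible vector. It is truncated because `D` may be nonzero outside the family.
    let Q : Finset V → ℝ := fun T => P T + t * if T ∈ singletons V ∪ F then D T else 0
    have hQload : ∀ e, dualLoad G F Q e = dualLoad G F P e + t * dualLoad G F D e := by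
      intro e
      rw [dualLoad_add_smul]
      congr 2
      refine Finset.sum_congr rfl fun T hT => ?_
      exact if_pos (Finset.mem_filter.1 hT).1
    have hQ : IsDualFeasible G c F Q := by
      refine ⟨fun S hS => ?_, fun e he => ?_, fun S hS => ?_⟩
      · simp only [Q, hP.1.eq_zero S hS, if_neg hS, mul_zero, add_zero]
      · rw [hQload]; exact ht1 e he
      · simp only [Q, if_pos (Finset.mem_union_right _ hS)]
        exact ht2 S hS
    have h1 := hP.2 Q hQ
    have h2 : dualValue F Q = dualValue F P + t * ∑ T ∈ singletons V ∪ F, D T := by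
      simp only [dualValue, Q]
      rw [Finset.sum_add_distrib, ← Finset.mul_sum]
      congr 2
      exact Finset.sum_congr rfl fun T hT => if_pos hT
    rw [h2] at h1
    have := mul_pos ht0 hcon
    linarith)
  -- The multipliers of the tight edges form the primal solution; those of the sets with value zero
  -- are the surpluses `μ` of their blossom inequalities.
  let x : Sym2 V → ℝ := fun e =>
    if e ∈ G.edgeSet ∧ dualLoad G F P e = c e then l (Sum.inl e) else 0
  let μ : Finset V → ℝ := fun S => if S ∈ F ∧ P S = 0 then l (Sum.inr S) else 0
  have hsum : ∀ S ∈ singletons V ∪ F, ∑ e ∈ cut G S, x e = 1 + μ S := by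
    intro S hS
    -- Comparing the coefficients of `S` gives the cut equation of `S`.
    have h1 := LinearMap.congr_fun hb (Pi.single S 1)
    simp only [LinearMap.coe_sum, Finset.sum_apply, ev, LinearMap.proj_apply,
      LinearMap.smul_apply, smul_eq_mul] at h1
    rw [Finset.sum_pi_single', if_pos hS, Fintype.sum_sum_type] at h1
    have h2 : ∀ e, l (Sum.inl e) * A (Sum.inl e) (Pi.single S 1) =
        if e ∈ cut G S then x e else 0 := by
      intro e
      by_cases he : e ∈ G.edgeSet ∧ dualLoad G F P e = c e
      · rw [hA1 e _ he.1 he.2, dualLoad, Finset.sum_pi_single']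
        simp only [x, if_pos he, Finset.mem_filter, hS, true_and]
        split_ifs <;> simp
      · simp [A, x, if_neg he]
    have h3 : ∀ T, l (Sum.inr T) * A (Sum.inr T) (Pi.single S 1) =
        if T = S then - μ S else 0 := by
      intro T
      by_cases hT : T ∈ F ∧ P T = 0
      · rw [hA2 T _ hT.1 hT.2]
        by_cases hTS : T = S
        · subst hTS; simp [μ, hT]
        · simp [hTS]
      · by_cases hTS : T = S
        · subst hTS; simp [A, μ, if_neg hT]
        · simp [A, if_neg hT, hTS]
    simp_rw [h2, h3] at h1
    rw [Finset.sum_ite_mem, Finset.univ_inter, Finset.sum_ite_eq',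
      if_pos (Finset.mem_univ _)] at h1
    linarith
  have hμ0 : ∀ S, S ∉ F → μ S = 0 := fun S h => if_neg fun h' => h h'.1
  refine ⟨x, ⟨fun e he => if_neg fun h => he h.1, fun u => ?_, fun S hS => ?_, fun e => ?_⟩,
    fun e he => ?_, fun S hS hPS => ?_⟩
  · rw [hsum _ (singleton_mem F u), hμ0, add_zero]
    intro h
    have := (hF _ h).2
    simp at this
  · rw [hsum _ (Finset.mem_union_right _ hS)]
    have : 0 ≤ μ S := by
      simp only [μ]; split_ifs
      exacts [hl _, le_rfl]
    linarith
  · simp only [x]; split_ifs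
    exacts [hl _, le_rfl]
  · by_contra hcon
    simp [x, hcon] at he
  · rw [hsum _ (Finset.mem_union_right _ hS)]
    simp [μ, hPS.ne']

/-- Complementary slackness for a unique primal optimal solution. -/
theorem IsUniquePrimalOptimal.complementary {P x : _} (hx : IsUniquePrimalOptimal G c F x)
    (hP : IsDualOptimal G c F P) (hF : IsOddFamily F) :
    (∀ e, 0 < x e → dualLoad G F P e = c e) ∧
      ∀ S ∈ F, 0 < P S → ∑ e ∈ cut G S, x e = 1 := by
  obtain ⟨y, hy, h1, h2⟩ := hP.exists_complementary hF
  have hcost : primalCost G c y = dualValue F P := by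
    rw [primalCost_eq_add (F := F) P hy.eq_zero, Finset.sum_eq_zero, zero_add]
    · refine Finset.sum_congr rfl fun T hT => ?_
      rcases Finset.mem_union.1 hT with h | h
      · obtain ⟨v, rfl⟩ := mem_singletons.1 h
        rw [hy.degree, mul_one]
      · rcases (hP.1.nonneg T h).lt_or_eq with h' | h'
        · rw [h2 T h h', mul_one]
        · rw [← h', zero_mul]
    · intro e _
      rcases (hy.nonneg e).lt_or_eq with h | h
      · rw [h1 e h, sub_self, zero_mul]
      · rw [← h, mul_zero]
  have : y = x := hx.2 y ⟨hy, fun z hz => hcost.trans_le (weak_duality hP.1 hz)⟩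
  subst this
  exact ⟨h1, h2⟩

end Duality

/-! ### Contraction to a partition and extension into its parts -/

section Lift

set_option linter.unusedSectionVars false

variable {V : Type*} [Fintype V] [DecidableEq V] {G : SimpleGraph V} {c : Sym2 V → ℝ}
  {F : Finset (Finset V)}

/-- A partition of the vertex set into singletons and members of `F`, given by the map that sends
a vertex to its part. -/
structure IsNodeMap (F : Finset (Finset V)) (B : V → Finset V) : Prop where
  mem : ∀ v, B v ∈ singletons V ∪ F
  self : ∀ v, v ∈ B v
  eq : ∀ u v, u ∈ B v → B u = B v

/-- A choice of near-perfect matchings `m S u` of `S \ {u}` for all `S`. -/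
structure IsMatchingSystem (G : SimpleGraph V) (F : Finset (Finset V))
    (m : Finset V → V → Finset (Sym2 V)) : Prop where
  matching : ∀ S ∈ singletons V ∪ F, ∀ u ∈ S, IsMatchingOn G (m S u) (S \ {u})
  card : ∀ S ∈ singletons V ∪ F, ∀ u ∈ S, ∀ T ∈ singletons V ∪ F,
    (m S u ∩ cut G T).card = if T ⊆ S ∧ u ∉ T then 1 else 0

theorem IsCriticalDual.exists_matchingSystem {Γ : Finset V → ℝ} (hΓ : IsCriticalDual G c F Γ)
    (hF : IsCriticalFamily G c F) :
    ∃ m, IsMatchingSystem G F m ∧ ∀ S ∈ singletons V ∪ F, ∀ u ∈ S, ∀ e ∈ m S u,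
      dualLoad G F Γ e = c e := by
  classical
  have : ∀ S u, ∃ M : Finset (Sym2 V), S ∈ singletons V ∪ F → u ∈ S →
      (∀ e ∈ M, dualLoad G F Γ e = c e) ∧
      IsMatchingOn G M (S \ {u}) ∧ ∀ T ∈ F, (M ∩ cut G T).card ≤ 1 := by
    intro S u
    by_cases h : S ∈ singletons V ∪ F ∧ u ∈ S
    · obtain ⟨M, hM⟩ := hΓ.exists_matching h.1 h.2
      exact ⟨M, fun _ _ => hM⟩
    · exact ⟨∅, fun h1 h2 => absurd ⟨h1, h2⟩ h⟩
  choose m hm using this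
  refine ⟨m, ⟨fun S hS u hu => (hm S u hS hu).2.1, fun S hS u hu T hT => ?_⟩,
    fun S hS u hu => (hm S u hS hu).1⟩
  exact card_inter_cut_eq hF.odd hF.laminar hS (hm S u hS hu).2.1 (hm S u hS hu).2.2 hT

/-- The maximal members of a laminar family containing all singletons form a partition. -/
theorem exists_nodeMap (hF : IsLaminar F) {K : Finset (Finset V)}
    (h1 : singletons V ⊆ K) (h2 : K ⊆ singletons V ∪ F) :
    ∃ B : V → Finset V, IsNodeMap F B ∧ (∀ v, B v ∈ K) ∧
      ∀ S ∈ K, ∀ v ∈ S, S ⊆ B v := by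
  classical
  have hlam := hF.union_singletons
  have : ∀ v, ∃ S, S ∈ K ∧ v ∈ S ∧ ∀ T ∈ K, v ∈ T → T ⊆ S := by
    intro v
    obtain ⟨S, hS⟩ := (K.filter (v ∈ ·)).exists_maximal
      ⟨{v}, Finset.mem_filter.2 ⟨h1 (mem_singletons.2 ⟨v, rfl⟩), by simp⟩⟩
    obtain ⟨hSK, hvS⟩ := Finset.mem_filter.1 hS.prop
    refine ⟨S, hSK, hvS, fun T hT hvT => ?_⟩
    rcases hlam T (h2 hT) S (h2 hSK) with h | h | h
    · exact absurd hvS (Finset.disjoint_left.1 h hvT)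
    · exact h
    · exact hS.le_of_ge (Finset.mem_filter.2 ⟨hT, hvT⟩) h
  choose B hB using this
  refine ⟨B, ⟨fun v => h2 (hB v).1, fun v => (hB v).2.1, fun u v huv => ?_⟩,
    fun v => (hB v).1, fun S hS v hv => (hB v).2.2 S hS hv⟩
  have h3 : B v ⊆ B u := (hB u).2.2 _ (hB v).1 huv
  have h4 : B u ⊆ B v := (hB v).2.2 _ (hB u).1 (h3 (hB v).2.1)
  exact h4.antisymm h3

variable {R : Type*} [CommSemiring R] {B : V → Finset V} {m : Finset V → V → Finset (Sym2 V)}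

/-- `y` vanishes on the edges inside the parts. -/
def IsOuter (B : V → Finset V) (y : Sym2 V → R) : Prop :=
  ∀ e : Sym2 V, (e.map B).IsDiag → y e = 0

/-- Extension of an edge vector into the parts by near-perfect matchings. -/
noncomputable def lift (G : SimpleGraph V) (B : V → Finset V)
    (m : Finset V → V → Finset (Sym2 V)) (y : Sym2 V → R) (e : Sym2 V) : R :=
  y e + ∑ u, if e ∈ m (B u) u then ∑ f ∈ cut G {u}, y f else 0

open Classical in
/-- The restriction of an edge vector to the edges between different parts. -/
noncomputable def outer (B : V → Finset V) (x : Sym2 V → R) (e : Sym2 V) : R :=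
  if (e.map B).IsDiag then 0 else x e

theorem isOuter_outer (x : Sym2 V → R) : IsOuter B (outer B x) := fun _ he => if_pos he

theorem outer_eq {x : Sym2 V → R} {e : Sym2 V} (h : ¬ (e.map B).IsDiag) :
    outer B x e = x e := if_neg h

namespace IsNodeMap

theorem mem_iff (hB : IsNodeMap F B) {u v : V} : u ∈ B v ↔ B u = B v :=
  ⟨hB.eq u v, fun h => h ▸ hB.self u⟩

theorem isDiag_of_inside (hB : IsNodeMap F B) {e : Sym2 V} {v : V} (h : ∀ u ∈ e, u ∈ B v) :
    (e.map B).IsDiag := by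
  induction e with
  | h a b =>
    rw [Sym2.map_mk, Sym2.mk_isDiag_iff]
    exact (hB.eq _ _ (h a (Sym2.mem_mk_left _ _))).trans
      (hB.eq _ _ (h b (Sym2.mem_mk_right _ _))).symm

theorem not_isDiag_of_mem_cut (hB : IsNodeMap F B) {e : Sym2 V} {v : V} (h : e ∈ cut G (B v)) :
    ¬ (e.map B).IsDiag := by
  obtain ⟨-, a, b, ha, hb, rfl⟩ := mem_cut.1 h
  rw [Sym2.map_mk, Sym2.mk_isDiag_iff]
  intro h
  exact hb (hB.mem_iff.2 (h.symm.trans (hB.eq _ _ ha)))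

/-- A member of `F` that is not inside a part is a union of parts. -/
theorem not_isDiag_of_mem_cut' (hF : IsLaminar F) (hB : IsNodeMap F B) {T : Finset V}
    (hT : T ∈ singletons V ∪ F) (hTB : ∀ v, ¬ T ⊆ B v) {e : Sym2 V} (h : e ∈ cut G T) :
    ¬ (e.map B).IsDiag := by
  obtain ⟨-, a, b, ha, hb, rfl⟩ := mem_cut.1 h
  rw [Sym2.map_mk, Sym2.mk_isDiag_iff]
  intro h
  rcases hF.union_singletons T hT _ (hB.mem a) with h1 | h1 | h1
  · exact Finset.disjoint_left.1 h1 ha (hB.self a)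
  · exact hTB a h1
  · exact hb (h1 (h ▸ hB.self b))

theorem isDiag_of_mem_matching (hB : IsNodeMap F B) (hm : IsMatchingSystem G F m) {e : Sym2 V}
    {u : V} (he : e ∈ m (B u) u) : (e.map B).IsDiag :=
  hB.isDiag_of_inside (v := u) fun _ hv =>
    (Finset.mem_sdiff.1 ((hm.matching _ (hB.mem u) u (hB.self u)).mem_of_mem he hv)).1

theorem sum_cut_outer (hB : IsNodeMap F B) (x : Sym2 V → R) (v : V) :
    ∑ e ∈ cut G (B v), outer B x e = ∑ e ∈ cut G (B v), x e :=
  Finset.sum_congr rfl fun _ he => outer_eq (hB.not_isDiag_of_mem_cut he)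

theorem sum_cut_lift (hB : IsNodeMap F B) (hm : IsMatchingSystem G F m) (y : Sym2 V → R)
    {T : Finset V} (hT : T ∈ singletons V ∪ F) :
    ∑ e ∈ cut G T, lift G B m y e = ∑ e ∈ cut G T, y e +
      ∑ u, if T ⊆ B u ∧ u ∉ T then ∑ f ∈ cut G {u}, y f else 0 := by
  simp only [lift]
  rw [Finset.sum_add_distrib, Finset.sum_comm]
  congr 1
  refine Finset.sum_congr rfl fun u _ => ?_
  have := hm.card _ (hB.mem u) u (hB.self u) T hT
  rw [← Finset.sum_filter, Finset.sum_const, Finset.filter_mem_eq_inter, Finset.inter_comm, this]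
  split_ifs <;> simp

/-- Each unit of `y` entering the part at `u` crosses `T` once: directly if `u ∈ T`, and otherwise
through the matching missing `u`. This is why the extension turns one equation per part into
equations for all family members inside it. -/
theorem sum_cut_lift_of_subset (hF : IsOddFamily F) (hB : IsNodeMap F B)
    (hm : IsMatchingSystem G F m) {y : Sym2 V → R} (hy : IsOuter B y)
    {T : Finset V} (hT : T ∈ singletons V ∪ F) {v : V} (hTv : T ⊆ B v) :
    ∑ e ∈ cut G T, lift G B m y e = ∑ e ∈ cut G (B v), y e := by
  have hout : ∀ S ⊆ B v, ∀ e ∈ inner G S, y e = 0 := fun S hS e he =>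
    hy e (hB.isDiag_of_inside fun u hu => hS ((mem_inner.1 he).2 u hu))
  rw [hB.sum_cut_lift hm y hT, sum_cut_eq_sum_sum (hout T hTv),
    sum_cut_eq_sum_sum (hout _ subset_rfl), ← Finset.sum_filter,
    ← Finset.sum_sdiff hTv, add_comm]
  congr 1
  refine Finset.sum_congr ?_ fun _ _ => rfl
  ext u
  simp only [Finset.mem_filter, Finset.mem_univ, true_and, Finset.mem_sdiff]
  refine and_congr_left fun _ => ⟨fun h => ?_, fun h => ?_⟩
  · obtain ⟨w, hw⟩ := hF.nonempty hT
    exact hB.mem_iff.2 ((hB.eq _ _ (h hw)).symm.trans (hB.eq _ _ (hTv hw)))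
  · rw [hB.eq _ _ h]; exact hTv

theorem sum_cut_lift_of_not_subset (hB : IsNodeMap F B)
    (hm : IsMatchingSystem G F m) (y : Sym2 V → R)
    {T : Finset V} (hT : T ∈ singletons V ∪ F) (hTB : ∀ v, ¬ T ⊆ B v) :
    ∑ e ∈ cut G T, lift G B m y e = ∑ e ∈ cut G T, y e := by
  rw [hB.sum_cut_lift hm y hT]
  simp [hTB]

theorem lift_eq_of_not_isDiag (hB : IsNodeMap F B) (hm : IsMatchingSystem G F m)
    (y : Sym2 V → R) {e : Sym2 V} (he : ¬ (e.map B).IsDiag) : lift G B m y e = y e := by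
  rw [lift, Finset.sum_eq_zero, add_zero]
  intro u _
  rw [if_neg fun h => he (hB.isDiag_of_mem_matching hm h)]

/-- A unique primal optimal solution is the lift of its outer part. -/
theorem eq_lift_outer (hF : IsCriticalFamily G c F) {Γ : Finset V → ℝ}
    (hΓ : IsDualFeasible G c F Γ) (hm : IsMatchingSystem G F m)
    (hmt : ∀ S ∈ singletons V ∪ F, ∀ u ∈ S, ∀ e ∈ m S u, dualLoad G F Γ e = c e)
    {x : Sym2 V → ℝ} (hx : IsUniquePrimalOptimal G c F x) (hB : IsNodeMap F B)
    (hBx : ∀ v, ∑ e ∈ cut G (B v), x e = 1) : x = lift G B m (outer B x) := by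
  have hxf := hx.1.1
  set z := lift G B m (outer B x) with hz
  have hout : ∀ e, 0 ≤ outer B x e := by
    intro e
    unfold outer
    split_ifs
    exacts [le_rfl, hxf.nonneg e]
  have hin : ∀ T ∈ singletons V ∪ F, ∀ v, T ⊆ B v → ∑ e ∈ cut G T, z e = 1 := by
    intro T hT v hTv
    rw [hz, hB.sum_cut_lift_of_subset hF.odd hm (isOuter_outer x) hT hTv, hB.sum_cut_outer, hBx]
  have hnin : ∀ T ∈ singletons V ∪ F, (∀ v, ¬ T ⊆ B v) →
      ∑ e ∈ cut G T, z e = ∑ e ∈ cut G T, x e := by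
    intro T hT hTB
    rw [hz, hB.sum_cut_lift_of_not_subset hm _ hT hTB]
    exact Finset.sum_congr rfl fun e he =>
      outer_eq (hB.not_isDiag_of_mem_cut' hF.laminar hT hTB he)
  have hle : ∀ T ∈ F, ∑ e ∈ cut G T, z e ≤ ∑ e ∈ cut G T, x e ∧ 1 ≤ ∑ e ∈ cut G T, z e := by
    intro T hT
    have hT' : T ∈ singletons V ∪ F := Finset.mem_union_right _ hT
    by_cases h : ∃ v, T ⊆ B v
    · obtain ⟨v, hv⟩ := h
      rw [hin T hT' v hv]
      exact ⟨hxf.blossom T hT, le_rfl⟩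
    · push Not at h
      rw [hnin T hT' h]
      exact ⟨le_rfl, hxf.blossom T hT⟩
  have hdeg : ∀ u : V, ∑ e ∈ cut G {u}, z e = 1 := fun u =>
    hin _ (singleton_mem F u) u (Finset.singleton_subset_iff.2 (hB.self u))
  have hzf : IsPrimalFeasible G F z := by
    refine ⟨fun e he => ?_, hdeg, fun S hS => (hle S hS).2, fun e => ?_⟩
    · rw [hz, lift, Finset.sum_eq_zero, add_zero]
      · unfold outer
        split_ifs
        exacts [rfl, hxf.eq_zero e he]
      · intro u _
        exact if_neg fun h => he ((hm.matching _ (hB.mem u) u (hB.self u)).1 e h)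
    · refine add_nonneg (hout e) (Finset.sum_nonneg fun u _ => ?_)
      split_ifs
      exacts [Finset.sum_nonneg fun f _ => hout f, le_rfl]
  -- Measured with `Γ`: inside the parts `z` uses only edges of zero reduced cost, outside it equals
  -- `x`, and no cut of a member of `F` gains value.
  have hcost : primalCost G c z ≤ primalCost G c x := by
    rw [primalCost_eq_add (F := F) Γ hzf.eq_zero, primalCost_eq_add (F := F) Γ hxf.eq_zero]
    refine add_le_add (Finset.sum_le_sum fun e _ => ?_) (Finset.sum_le_sum fun T hT => ?_)
    · by_cases he : (e.map B).IsDiag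
      · by_cases h : ∃ u, e ∈ m (B u) u
        · obtain ⟨u, hu⟩ := h
          rw [hmt _ (hB.mem u) u (hB.self u) e hu]; simp
        · push Not at h
          have : z e = 0 := by
            rw [hz, lift, Finset.sum_eq_zero fun u _ => if_neg (h u), add_zero]
            exact isOuter_outer x e he
          rw [this, mul_zero]
          exact reducedCost_mul_nonneg hΓ hxf e
      · rw [hz, hB.lift_eq_of_not_isDiag hm _ he, outer_eq he]
    · rcases Finset.mem_union.1 hT with h | h
      · obtain ⟨v, rfl⟩ := mem_singletons.1 h
        rw [hdeg, hxf.degree]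
      · exact mul_le_mul_of_nonneg_left (hle T h).1 (hΓ.nonneg T h)
  exact (hx.2 z ⟨hzf, fun y hy => hcost.trans (hx.1.2 y hy)⟩).symm

/-- If a positive edge leaves the part of `a` at `a`, then the matching of that part missing `a`
consists of positive edges. -/
theorem pos_of_mem_matching (hB : IsNodeMap F B) {x : Sym2 V → ℝ} (hx0 : ∀ e, 0 ≤ x e)
    (hx : x = lift G B m (outer B x)) {a : V} {e : Sym2 V} (he : e ∈ cut G {a})
    (hea : e ∈ cut G (B a)) (hxe : 0 < x e) {f : Sym2 V} (hf : f ∈ m (B a) a) : 0 < x f := by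
  have hout : ∀ e, 0 ≤ outer B x e := by
    intro e
    unfold outer
    split_ifs
    exacts [le_rfl, hx0 e]
  have h1 : 0 < ∑ g ∈ cut G {a}, outer B x g := by
    refine Finset.sum_pos' (fun g _ => hout g) ⟨e, he, ?_⟩
    rwa [outer_eq (hB.not_isDiag_of_mem_cut hea)]
  rw [hx, lift]
  refine add_pos_of_nonneg_of_pos (hout f)
    (Finset.sum_pos' (fun u _ => ?_) ⟨a, Finset.mem_univ a, ?_⟩)
  · split_ifs
    exacts [Finset.sum_nonneg fun g _ => hout g, le_rfl]
  · rwa [if_pos hf]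

end IsNodeMap

end Lift

/-! ### Half-integrality of the unique optimum -/

section HalfIntegral

set_option linter.unusedSectionVars false

variable {V : Type*} [Fintype V] [DecidableEq V] {G : SimpleGraph V} {c : Sym2 V → ℝ}
  {F : Finset (Finset V)}

/-- The absolute value allows one step size to serve both signs of a perturbation. -/
theorem eventually_mul_abs_le {a b : ℝ} (ha : 0 ≤ a) (hab : a = 0 → b = 0) :
    ∀ᶠ t : ℝ in nhdsWithin 0 (Set.Ioi 0), t * |b| ≤ a := by
  rcases ha.lt_or_eq with h | h
  · have : Filter.Tendsto (fun t : ℝ => t * |b|) (nhdsWithin 0 (Set.Ioi 0))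
        (nhds (0 * |b|)) :=
      (Continuous.tendsto (by fun_prop) 0).mono_left nhdsWithin_le_nhds
    rw [zero_mul] at this
    exact (this.eventually (eventually_lt_nhds h)).mono fun t ht => ht.le
  · refine Filter.Eventually.of_forall fun t => ?_
    rw [hab h.symm, ← h]; simp

/-- A unique primal optimal solution is a vertex of the feasible polyhedron. -/
theorem IsUniquePrimalOptimal.eq_zero_of_direction {x : Sym2 V → ℝ}
    (hx : IsUniquePrimalOptimal G c F x) {w : Sym2 V → ℝ} (hw0 : ∀ e, x e = 0 → w e = 0)
    (hwdeg : ∀ v, ∑ e ∈ cut G {v}, w e = 0)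
    (hwF : ∀ T ∈ F, ∑ e ∈ cut G T, x e = 1 → ∑ e ∈ cut G T, w e = 0) : w = 0 := by
  have hxf := hx.1.1
  have h1 : ∀ e, ∀ᶠ t : ℝ in nhdsWithin 0 (Set.Ioi 0), t * |w e| ≤ x e := fun e =>
    eventually_mul_abs_le (hxf.nonneg e) (hw0 e)
  have h2 : ∀ T, ∀ᶠ t : ℝ in nhdsWithin 0 (Set.Ioi 0),
      T ∈ F → t * |∑ e ∈ cut G T, w e| ≤ ∑ e ∈ cut G T, x e - 1 := by
    intro T
    by_cases hT : T ∈ F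
    · refine (eventually_mul_abs_le (sub_nonneg.2 (hxf.blossom T hT)) fun h =>
        hwF T hT (sub_eq_zero.1 h)).mono fun t ht _ => ht
    · exact Filter.Eventually.of_forall fun t h => absurd h hT
  obtain ⟨t, ht1, ht2, ht0⟩ := ((Filter.eventually_all.2 h1).and
    ((Filter.eventually_all.2 h2).and self_mem_nhdsWithin)).exists
  have ht0 : 0 < t := ht0
  have hfeas : ∀ s : ℝ, |s| = t → IsPrimalFeasible G F (fun e => x e + s * w e) := by
    intro s hs
    refine ⟨fun e he => ?_, fun u => ?_, fun T hT => ?_, fun e => ?_⟩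
    · rw [hxf.eq_zero e he, hw0 e (hxf.eq_zero e he)]; simp
    · rw [Finset.sum_add_distrib, ← Finset.mul_sum, hwdeg, hxf.degree]; simp
    · rw [Finset.sum_add_distrib, ← Finset.mul_sum]
      have := ht2 T hT
      rw [← hs, ← abs_mul] at this
      linarith [neg_abs_le (s * ∑ e ∈ cut G T, w e)]
    · have := ht1 e
      rw [← hs, ← abs_mul] at this
      linarith [neg_abs_le (s * w e)]
  have hcost : ∀ s : ℝ, primalCost G c (fun e => x e + s * w e) =
      primalCost G c x + s * primalCost G c w := by
    intro s
    simp only [primalCost]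
    rw [Finset.mul_sum, ← Finset.sum_add_distrib]
    exact Finset.sum_congr rfl fun e _ => by ring
  have hp := hfeas t (abs_of_pos ht0)
  have hn := hfeas (-t) (by rw [abs_neg, abs_of_pos ht0])
  have hp' := hx.1.2 _ hp
  have hn' := hx.1.2 _ hn
  rw [hcost] at hp' hn'
  -- Neither of the opposite steps lowers the cost, so the cost is constant along `w`, and
  -- uniqueness applies.
  have h0 : t * primalCost G c w = 0 := by linarith
  have := hx.2 _ ⟨hp, fun y hy => by rw [hcost, h0, add_zero]; exact hx.1.2 y hy⟩
  ext e
  have he := congrFun this e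
  have : t * w e = 0 := by linarith
  exact (mul_eq_zero.1 this).resolve_left ht0.ne'

namespace IsNodeMap

variable {B : V → Finset V}

theorem eq_or_eq_of_mem_cut (hB : IsNodeMap F B) {p q w : V} (h : s(p, q) ∈ cut G (B w)) :
    B w = B p ∨ B w = B q := by
  rcases (mk_mem_cut.1 h).2 with h | h
  · exact Or.inl (hB.eq _ _ h.1).symm
  · exact Or.inr (hB.eq _ _ h.1).symm

theorem eq_or_eq_of_mem_cut_of_mem_cut (hB : IsNodeMap F B) {e : Sym2 V} {u v w : V}
    (hu : e ∈ cut G (B u)) (hv : e ∈ cut G (B v)) (huv : B u ≠ B v) (hw : e ∈ cut G (B w)) :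
    B u = B w ∨ B v = B w := by
  induction e with
  | h p q =>
    rcases hB.eq_or_eq_of_mem_cut hu with h1 | h1 <;>
    rcases hB.eq_or_eq_of_mem_cut hv with h2 | h2 <;>
    rcases hB.eq_or_eq_of_mem_cut hw with h3 | h3
    · exact absurd (h1.trans h2.symm) huv
    · exact absurd (h1.trans h2.symm) huv
    · exact Or.inl (h1.trans h3.symm)
    · exact Or.inr (h2.trans h3.symm)
    · exact Or.inr (h2.trans h3.symm)
    · exact Or.inl (h1.trans h3.symm)
    · exact absurd (h1.trans h2.symm) huv
    · exact absurd (h1.trans h2.symm) huv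

/-- A fractional perfect matching of the contracted graph contains in its support a permutation
of the parts. -/
theorem exists_perm (hB : IsNodeMap F B) {x : Sym2 V → ℝ} (hx0 : ∀ e, 0 ≤ x e)
    (hBx : ∀ v, ∑ e ∈ cut G (B v), x e = 1) :
    ∃ (σ : Equiv.Perm (Finset.univ.image B)) (f : Finset.univ.image B → Sym2 V),
      ∀ a, a ≠ σ a ∧ f a ∈ cut G a.1 ∧ f a ∈ cut G (σ a).1 ∧ 0 < x (f a) := by
  classical
  have hN : ∀ a : Finset.univ.image B, ∃ v, B v = a.1 := fun a => by
    obtain ⟨v, -, hv⟩ := Finset.mem_image.1 a.2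
    exact ⟨v, hv⟩
  -- The weight of `x` between two parts. An edge leaving a part ends in exactly one other part, so
  -- this symmetric matrix has row sums one, and Birkhoff's theorem applies.
  let X : Matrix (Finset.univ.image B) (Finset.univ.image B) ℝ := fun a b =>
    if a = b then 0 else ∑ e ∈ cut G a.1, if e ∈ cut G b.1 then x e else 0
  have hX0 : ∀ a b, 0 ≤ X a b := by
    intro a b
    simp only [X]
    split_ifs
    · exact le_rfl
    · refine Finset.sum_nonneg fun e _ => ?_
      split_ifs
      exacts [hx0 e, le_rfl]
  have hXsymm : ∀ a b, X a b = X b a := by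
    intro a b
    simp only [X, eq_comm (a := a) (b := b)]
    congr 1
    rw [← Finset.sum_filter, ← Finset.sum_filter, Finset.filter_mem_eq_inter,
      Finset.filter_mem_eq_inter, Finset.inter_comm]
  have hrow : ∀ a, ∑ b, X a b = 1 := by
    intro a
    obtain ⟨v, hv⟩ := hN a
    have h1 : ∀ b, X a b = ∑ e ∈ cut G a.1, if a = b then 0 else
        if e ∈ cut G b.1 then x e else 0 := by
      intro b
      by_cases hab : a = b <;> simp [X, hab]
    simp_rw [h1]
    rw [Finset.sum_comm, ← hBx v, hv]
    refine Finset.sum_congr rfl fun e he => ?_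
    obtain ⟨heE, p, q, hp, hq, rfl⟩ := mem_cut.1 he
    have hpa : B p = a.1 := by rw [← hv]; exact hB.eq _ _ (hv ▸ hp)
    have hqa : B q ≠ a.1 := fun h => hq (h ▸ hB.self q)
    have hmem : s(p, q) ∈ cut G (B q) := by
      rw [mk_mem_cut]
      exact ⟨heE, Or.inr ⟨hB.self q, fun h => hqa ((hB.eq _ _ h).symm.trans hpa)⟩⟩
    rw [Finset.sum_eq_single (⟨B q, by simp⟩ : Finset.univ.image B)]
    · rw [if_neg (fun h => hqa (by rw [h])), if_pos hmem]
    · rintro b - hb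
      split_ifs with h2 h3
      · rfl
      · exfalso
        obtain ⟨w, hw⟩ := hN b
        rw [← hw] at h3
        rcases hB.eq_or_eq_of_mem_cut h3 with h | h
        · exact h2 (Subtype.ext (hpa.symm.trans (h.symm.trans hw)))
        · exact hb (Subtype.ext (hw.symm.trans h))
      · rfl
    · simp
  have hX : X ∈ doublyStochastic ℝ (Finset.univ.image B) := by
    rw [mem_doublyStochastic_iff_sum]
    refine ⟨hX0, hrow, fun b => ?_⟩
    rw [← hrow b]
    exact Finset.sum_congr rfl fun a _ => hXsymm a b
  obtain ⟨w, hw0, hw1, hwX⟩ := exists_eq_sum_perm_of_mem_doublyStochastic hX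
  obtain ⟨σ, -, hσ⟩ : ∃ σ ∈ Finset.univ, 0 < w σ := by
    by_contra hcon
    push Not at hcon
    have := Finset.sum_nonpos hcon
    rw [hw1] at this
    linarith
  have hpos : ∀ a, 0 < X a (σ a) := by
    intro a
    rw [← hwX, Matrix.sum_apply]
    refine Finset.sum_pos' (fun τ _ => ?_) ⟨σ, Finset.mem_univ _, ?_⟩
    · rw [Matrix.smul_apply, smul_eq_mul]
      refine mul_nonneg (hw0 τ) ?_
      rw [Equiv.Perm.permMatrix, PEquiv.toMatrix_apply]
      split_ifs <;> simp
    · rw [Matrix.smul_apply, smul_eq_mul, Equiv.Perm.permMatrix, PEquiv.toMatrix_apply]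
      simpa using hσ
  have : ∀ a, ∃ e, a ≠ σ a ∧ e ∈ cut G a.1 ∧ e ∈ cut G (σ a).1 ∧ 0 < x e := by
    intro a
    have h := hpos a
    have hne : a ≠ σ a := fun h' => by
      simp only [X, if_pos h'] at h
      exact lt_irrefl _ h
    simp only [X, if_neg hne] at h
    by_contra hcon
    push Not at hcon
    refine absurd (Finset.sum_nonpos fun e he => ?_) (not_le.2 h)
    split_ifs with h3
    exacts [hcon e hne he h3, le_rfl]
  choose f hf using this
  exact ⟨σ, f, hf⟩

end IsNodeMap

/-- A unique primal optimal solution for a critical family is half-integral. -/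
theorem IsUniquePrimalOptimal.half_integral (hF : IsCriticalFamily G c F) {x : Sym2 V → ℝ}
    (hx : IsUniquePrimalOptimal G c F x) (e : Sym2 V) : ∃ k : ℕ, x e = k / 2 := by
  classical
  obtain ⟨Γ, hΓ⟩ := hF.exists_dual
  obtain ⟨m, hm, hmt⟩ := hΓ.exists_matchingSystem hF
  have hxf := hx.1.1
  obtain ⟨B, hB, hBK, hBmax⟩ := exists_nodeMap hF.laminar
    (K := (singletons V ∪ F).filter fun S => ∑ e ∈ cut G S, x e = 1)
    (by
      intro S hS
      refine Finset.mem_filter.2 ⟨Finset.mem_union_left _ hS, ?_⟩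
      obtain ⟨v, rfl⟩ := mem_singletons.1 hS
      exact hxf.degree v)
    (Finset.filter_subset _ _)
  have hBx : ∀ v, ∑ e ∈ cut G (B v), x e = 1 := fun v => (Finset.mem_filter.1 (hBK v)).2
  have hlift := hB.eq_lift_outer hF hΓ.feasible hm hmt hx hBx
  obtain ⟨σ, f, hf⟩ := hB.exists_perm hxf.nonneg hBx
  have hN : ∀ a : Finset.univ.image B, ∃ v, B v = a.1 := fun a => by
    obtain ⟨v, -, hv⟩ := Finset.mem_image.1 a.2
    exact ⟨v, hv⟩
  -- Half of every edge chosen along the permutation. Each part is once a source and once a target,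
  -- which gives cut value one; a cycle of length two may put both halves on one edge.
  let y : Sym2 V → ℝ := fun e => ∑ a, if e = f a then 1 / 2 else 0
  have hysum : ∀ A : Finset (Sym2 V), ∑ e ∈ A, y e = ∑ a, if f a ∈ A then 1 / 2 else 0 := by
    intro A
    simp only [y]
    rw [Finset.sum_comm]
    exact Finset.sum_congr rfl fun a _ => Finset.sum_ite_eq' _ _ _
  have hyB : ∀ v, ∑ e ∈ cut G (B v), y e = 1 := by
    intro v
    rw [hysum]
    let b : Finset.univ.image B := ⟨B v, by simp⟩
    have h1 : ∀ a, (if f a ∈ cut G (B v) then (1 / 2 : ℝ) else 0) =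
        (if a = b then 1 / 2 else 0) + (if σ a = b then 1 / 2 else 0) := by
      intro a
      obtain ⟨hne, ha1, ha2, -⟩ := hf a
      by_cases hab : a = b
      · have : σ a ≠ b := fun h => hne (hab.trans h.symm)
        have hmem : f a ∈ cut G (B v) := by
          have h : a.1 = B v := by rw [hab]
          rwa [← h]
        simp [hab ▸ this, hab ▸ hmem, hab]
      · by_cases hab' : σ a = b
        · have hmem : f a ∈ cut G (B v) := by
            have h : (σ a).1 = B v := by rw [hab']
            rwa [← h]
          simp [hab, hab', hmem]
        · have hmem : f a ∉ cut G (B v) := by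
            intro hmem
            obtain ⟨u, hu⟩ := hN a
            obtain ⟨w, hw⟩ := hN (σ a)
            rcases hB.eq_or_eq_of_mem_cut_of_mem_cut (u := u) (v := w) (w := v)
              (hu ▸ ha1) (hw ▸ ha2) (fun h => hne (Subtype.ext (hu.symm.trans (h.trans hw))))
              hmem with h | h
            · exact hab (Subtype.ext (hu.symm.trans h))
            · exact hab' (Subtype.ext (hw.symm.trans h))
          simp [hab, hab', hmem]
    simp_rw [h1]
    rw [Finset.sum_add_distrib, Equiv.sum_comp σ (fun a => if a = b then (1 / 2 : ℝ) else 0)]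
    simp
    norm_num
  have hyout : IsOuter B y := by
    intro e he
    refine Finset.sum_eq_zero fun a _ => if_neg ?_
    rintro rfl
    obtain ⟨u, hu⟩ := hN a
    exact hB.not_isDiag_of_mem_cut (hu ▸ (hf a).2.1) he
  have hyin : ∀ T ∈ singletons V ∪ F, ∑ e ∈ cut G T, x e = 1 →
      ∑ e ∈ cut G T, lift G B m y e = 1 := by
    intro T hT hxT
    obtain ⟨v, hv⟩ := hF.odd.nonempty hT
    rw [hB.sum_cut_lift_of_subset hF.odd hm hyout hT
      (hBmax T (Finset.mem_filter.2 ⟨hT, hxT⟩) v hv), hyB]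
  -- The difference is supported in `supp(x)` and vanishes on all constraints tight at `x`.
  have hxy : (fun e => x e - lift G B m y e) = 0 := by
    refine hx.eq_zero_of_direction (fun e he => ?_) (fun v => ?_) (fun T hT hxT => ?_)
    · have h1 : y e = 0 := by
        refine Finset.sum_eq_zero fun a _ => if_neg ?_
        rintro rfl
        exact (hf a).2.2.2.ne' he
      rw [he, lift, h1, Finset.sum_eq_zero, add_zero, sub_zero]
      intro u _
      split_ifs with heu
      · rw [hysum]
        refine Finset.sum_eq_zero fun a _ => if_neg fun ha => ?_
        obtain ⟨w, hw⟩ := hN a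
        have hcut : f a ∈ cut G (B u) := by
          have hnd := hB.not_isDiag_of_mem_cut (hw ▸ (hf a).2.1)
          obtain ⟨hE, p, hp⟩ := mem_cut_singleton.1 ha
          rw [hp, Sym2.map_mk, Sym2.mk_isDiag_iff] at hnd
          rw [hp] at hE ⊢
          rw [mk_mem_cut]
          exact ⟨hE, Or.inl ⟨hB.self u, fun h => hnd (hB.eq _ _ h).symm⟩⟩
        exact (hB.pos_of_mem_matching hxf.nonneg hlift ha hcut (hf a).2.2.2 heu).ne' he
      · rfl
    · rw [Finset.sum_sub_distrib, hxf.degree, hyin _ (singleton_mem F v) (hxf.degree v), sub_self]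
    · rw [Finset.sum_sub_distrib, hxT, hyin T (Finset.mem_union_right _ hT) hxT, sub_self]
  have hxe : x e = lift G B m y e := sub_eq_zero.1 (congrFun hxy e)
  refine ⟨(∑ a, if e = f a then 1 else 0) +
    ∑ u, if e ∈ m (B u) u then ∑ a, (if f a ∈ cut G {u} then 1 else 0) else 0, ?_⟩
  rw [hxe, lift, Nat.cast_add, add_div]
  congr 1
  · simp only [y]
    push_cast
    rw [Finset.sum_div]
    refine Finset.sum_congr rfl fun a _ => ?_
    split_ifs <;> simp
  · push_cast
    rw [Finset.sum_div]
    refine Finset.sum_congr rfl fun u _ => ?_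
    split_ifs
    · rw [hysum, Finset.sum_div]
      refine Finset.sum_congr rfl fun a _ => ?_
      split_ifs <;> simp
    · simp

end HalfIntegral

/-! ### Odd cycles of the support and their interaction with the parts -/

section Circuit

set_option linter.unusedSectionVars false

variable {V : Type*} [Fintype V] [DecidableEq V] {G : SimpleGraph V} {c : Sym2 V → ℝ}
  {F : Finset (Finset V)} {x : Sym2 V → ℝ}

/-- The properties of the vertex sets of odd cycles in `supp(x)` that are used below. -/
structure IsOddCircuit (G : SimpleGraph V) (x : Sym2 V → ℝ) (U : Finset V) : Prop where
  nonempty : U.Nonempty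
  near : ∀ u ∈ U, ∃ N : Finset (Sym2 V), IsMatchingOn G N (U \ {u}) ∧ ∀ e ∈ N, 0 < x e
  nbr : ∀ u ∈ U, ∃ a b, a ≠ b ∧ a ∈ U ∧ b ∈ U ∧ 0 < x s(u, a) ∧ 0 < x s(u, b)

/-- Every second edge of a path on `2 * k` vertices, starting with the first one. -/
theorem exists_matching_of_injOn (f : ℕ → V) (k : ℕ) (hinj : Set.InjOn f (Set.Icc 1 (2 * k)))
    (hadj : ∀ i, 1 ≤ i → i < 2 * k → G.Adj (f i) (f (i + 1)) ∧ 0 < x s(f i, f (i + 1))) :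
    ∃ N : Finset (Sym2 V), IsMatchingOn G N ((Finset.Icc 1 (2 * k)).image f) ∧
      ∀ e ∈ N, 0 < x e := by
  induction k with
  | zero => exact ⟨∅, by simpa using isMatchingOn_empty, by simp⟩
  | succ k ih =>
    obtain ⟨N, hN, hNx⟩ := ih
      (hinj.mono (Set.Icc_subset_Icc_right (by omega))) (fun i h1 h2 => hadj i h1 (by omega))
    obtain ⟨h1, h2⟩ := hadj (2 * k + 1) (by omega) (by omega)
    have hnot : ∀ j, 2 * k < j → j ≤ 2 * (k + 1) → f j ∉ (Finset.Icc 1 (2 * k)).image f := by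
      intro j hj hj' hmem
      obtain ⟨i, hi, hij⟩ := Finset.mem_image.1 hmem
      rw [Finset.mem_Icc] at hi
      have := hinj (Set.mem_Icc.2 ⟨hi.1, by omega⟩) (Set.mem_Icc.2 ⟨by omega, hj'⟩) hij
      omega
    refine ⟨insert s(f (2 * k + 1), f (2 * k + 1 + 1)) N, ?_, ?_⟩
    · have hset : (Finset.Icc 1 (2 * (k + 1))).image f = insert (f (2 * k + 1))
          (insert (f (2 * k + 1 + 1)) ((Finset.Icc 1 (2 * k)).image f)) := by
        rw [← Finset.image_insert, ← Finset.image_insert]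
        congr 1
        ext i
        simp only [Finset.mem_Icc, Finset.mem_insert]
        omega
      rw [hset]
      exact hN.insert h1 (hnot _ (by omega) (by omega)) (hnot _ (by omega) (by omega))
    · intro e he
      rcases Finset.mem_insert.1 he with rfl | he
      exacts [h2, hNx e he]

theorem IsOddCycleSet.isOddCircuit (hx : ∀ e, e ∉ G.edgeSet → x e = 0) {U : Finset V}
    (hU : IsOddCycleSet x U) : IsOddCircuit G x U := by
  obtain ⟨v, p, hp, hodd, rfl⟩ := hU
  have hrot : ∀ u ∈ p.support.toFinset, ∃ q : (supportGraph x).Walk u u, q.IsCycle ∧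
      Odd q.length ∧ q.support.toFinset = p.support.toFinset := by
    intro u hu
    rw [List.mem_toFinset] at hu
    refine ⟨p.rotate u hu, (SimpleGraph.Walk.isCycle_rotate hu).2 hp, ?_, ?_⟩
    · rwa [SimpleGraph.Walk.length_rotate]
    · ext w
      simp [SimpleGraph.Walk.mem_support_rotate_iff]
  have hsupp : ∀ a b, (supportGraph x).Adj a b → G.Adj a b ∧ 0 < x s(a, b) := by
    intro a b hab
    have h : 0 < x s(a, b) := ((SimpleGraph.fromEdgeSet_adj _).1 hab).1
    refine ⟨?_, h⟩
    by_contra hcon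
    exact h.ne' (hx _ hcon)
  refine ⟨⟨v, by simp⟩, fun u hu => ?_, fun u hu => ?_⟩
  · obtain ⟨q, hq, ⟨k, hk⟩, hqU⟩ := hrot u hu
    have hinj := hq.getVert_injOn
    have hset : p.support.toFinset \ {u} = (Finset.Icc 1 (2 * k)).image q.getVert := by
      rw [← hqU]
      ext w
      simp only [Finset.mem_sdiff, List.mem_toFinset, Finset.mem_singleton, Finset.mem_image,
        Finset.mem_Icc, SimpleGraph.Walk.mem_support_iff_exists_getVert]
      constructor
      · rintro ⟨⟨n, rfl, hn⟩, hne⟩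
        refine ⟨n, ⟨?_, ?_⟩, rfl⟩
        · rcases Nat.eq_zero_or_pos n with rfl | h
          · exact absurd q.getVert_zero hne
          · exact h
        · rcases hn.lt_or_eq with h | rfl
          · omega
          · exact absurd q.getVert_length hne
      · rintro ⟨n, ⟨hn1, hn2⟩, rfl⟩
        refine ⟨⟨n, rfl, by omega⟩, fun h => ?_⟩
        have := hinj (show n ∈ {i | 1 ≤ i ∧ i ≤ q.length} from ⟨hn1, by omega⟩)
          (show q.length ∈ {i | 1 ≤ i ∧ i ≤ q.length} from ⟨by omega, le_rfl⟩)
          (h.trans q.getVert_length.symm)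
        omega
    rw [hset]
    refine exists_matching_of_injOn q.getVert k (hinj.mono fun i hi => ?_) fun i hi1 hi2 =>
      hsupp _ _ (q.adj_getVert_succ (by omega))
    exact ⟨hi.1, hi.2.trans (by omega)⟩
  · obtain ⟨q, hq, -, hqU⟩ := hrot u hu
    have h3 := hq.three_le_length
    have hmem : ∀ i, q.getVert i ∈ p.support.toFinset := fun i => by
      rw [← hqU, List.mem_toFinset]; exact q.getVert_mem_support i
    refine ⟨q.getVert 1, q.getVert (q.length - 1), fun h => ?_, hmem _, hmem _, ?_, ?_⟩
    · have := hq.getVert_injOn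
        (show 1 ∈ {i | 1 ≤ i ∧ i ≤ q.length} from ⟨le_rfl, by omega⟩)
        (show q.length - 1 ∈ {i | 1 ≤ i ∧ i ≤ q.length} from ⟨by omega, by omega⟩) h
      omega
    · have := q.adj_getVert_succ (i := 0) (by omega)
      rw [q.getVert_zero] at this
      exact (hsupp _ _ this).2
    · have := q.adj_getVert_succ (i := q.length - 1) (by omega)
      rw [Nat.sub_add_cancel (by omega), q.getVert_length] at this
      rw [Sym2.eq_swap]
      exact (hsupp _ _ this).2

namespace IsOddCircuit

variable {U : Finset V}

theorem odd_card (hU : IsOddCircuit G x U) : Odd U.card := by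
  obtain ⟨u, hu⟩ := hU.nonempty
  obtain ⟨N, hN, -⟩ := hU.near u hu
  have h1 := hN.even_card
  rw [Finset.sdiff_singleton_eq_erase, Finset.card_erase_of_mem hu] at h1
  have h2 := Finset.card_pos.2 hU.nonempty
  rw [Nat.even_sub (by omega)] at h1
  rw [← Nat.not_even_iff_odd]
  simp_all

/-- Remove a vertex of `U` inside or outside `T`, whichever leaves an odd number in `T`; the
near-perfect matching of the rest must then cross `T`. -/
theorem exists_cross (hU : IsOddCircuit G x U) {T : Finset V} (h1 : (U ∩ T).Nonempty)
    (h2 : ¬ U ⊆ T) : ∃ a ∈ U, a ∈ T ∧ ∃ b, b ∉ T ∧ 0 < x s(a, b) := by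
  have key : ∀ u ∈ U, Odd (((U \ {u}) ∩ T).card) →
      ∃ a ∈ U, a ∈ T ∧ ∃ b, b ∉ T ∧ 0 < x s(a, b) := by
    intro u hu hodd
    obtain ⟨N, hN, hNx⟩ := hU.near u hu
    have hne : N ∩ cut G T ≠ ∅ := fun h =>
      (Nat.not_even_iff_odd.2 hodd) (hN.even_card_of_inter_cut h)
    obtain ⟨e, he⟩ := Finset.nonempty_iff_ne_empty.2 hne
    rw [Finset.mem_inter, mem_cut] at he
    obtain ⟨heN, -, a, b, ha, hb, rfl⟩ := he
    exact ⟨a, (Finset.mem_sdiff.1 (hN.mem_of_mem heN (Sym2.mem_mk_left _ _))).1, ha, b, hb,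
      hNx _ heN⟩
  rcases Nat.even_or_odd (U ∩ T).card with h | h
  · obtain ⟨u, hu⟩ := h1
    rw [Finset.mem_inter] at hu
    refine key u hu.1 ?_
    have h3 : (U \ {u}) ∩ T = (U ∩ T).erase u := by
      rw [Finset.sdiff_singleton_eq_erase, Finset.erase_inter]
    have hpos := Finset.card_pos.2 ⟨u, Finset.mem_inter.2 hu⟩
    rw [h3, Finset.card_erase_of_mem (Finset.mem_inter.2 hu), Nat.odd_sub (by omega)]
    simp [h]
  · obtain ⟨u, hu, huT⟩ := Finset.not_subset.1 h2
    refine key u hu ?_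
    have h3 : (U \ {u}) ∩ T = U ∩ T := by
      rw [Finset.sdiff_singleton_eq_erase, Finset.erase_inter, Finset.erase_eq_of_notMem]
      simp [huT]
    rwa [h3]

/-- Two cycle edges at `a` already use up the degree one, leaving no room for a third edge of weight
at least one half. -/
theorem mem_of_pos (hU : IsOddCircuit G x U) (hx : IsPrimalFeasible G F x)
    (hhalf : ∀ e, 0 < x e → 1 / 2 ≤ x e) {a b : V} (ha : a ∈ U) (hab : 0 < x s(a, b)) :
    b ∈ U := by
  obtain ⟨p, q, hpq, hp, hq, hxp, hxq⟩ := hU.nbr a ha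
  by_contra hb
  have hbp : b ≠ p := fun h => hb (h ▸ hp)
  have hbq : b ≠ q := fun h => hb (h ▸ hq)
  have hmem : ∀ w, 0 < x s(a, w) → s(a, w) ∈ cut G {a} := fun w hw => by
    rw [mem_cut_singleton]
    refine ⟨?_, Sym2.mem_mk_left _ _⟩
    by_contra hcon
    exact hw.ne' (hx.eq_zero _ hcon)
  have hsub : ({s(a, b), s(a, p), s(a, q)} : Finset (Sym2 V)) ⊆ cut G {a} := by
    intro e he
    simp only [Finset.mem_insert, Finset.mem_singleton] at he
    rcases he with rfl | rfl | rfl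
    exacts [hmem _ hab, hmem _ hxp, hmem _ hxq]
  have h1 := Finset.sum_le_sum_of_subset_of_nonneg (f := x) hsub fun e _ _ => hx.nonneg e
  rw [hx.degree, Finset.sum_insert, Finset.sum_insert, Finset.sum_singleton] at h1
  · linarith [hhalf _ hab, hhalf _ hxp, hhalf _ hxq]
  · rw [Finset.mem_singleton, Sym2.congr_right]; exact hpq
  · simp only [Finset.mem_insert, Finset.mem_singleton, Sym2.congr_right, not_or]
    exact ⟨hbp, hbq⟩

theorem eq_of_inter_nonempty {U' : Finset V} (hU : IsOddCircuit G x U)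
    (hU' : IsOddCircuit G x U') (hx : IsPrimalFeasible G F x)
    (hhalf : ∀ e, 0 < x e → 1 / 2 ≤ x e) (h : (U ∩ U').Nonempty) : U = U' := by
  have key : ∀ {A B : Finset V}, IsOddCircuit G x A → IsOddCircuit G x B →
      (A ∩ B).Nonempty → A ⊆ B := by
    intro A B hA hB hAB
    by_contra hcon
    obtain ⟨a, -, haB, b, hb, hab⟩ := hA.exists_cross hAB hcon
    exact hb (hB.mem_of_pos hx hhalf haB hab)
  exact (key hU hU' h).antisymm (key hU' hU (by rwa [Finset.inter_comm]))

theorem three_le_card (hU : IsOddCircuit G x U) : 3 ≤ U.card := by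
  obtain ⟨u, hu⟩ := hU.nonempty
  obtain ⟨a, b, hab, ha, hb, -, -⟩ := hU.nbr u hu
  have h2 : 1 < U.card := Finset.one_lt_card.2 ⟨a, ha, b, hb, hab⟩
  obtain ⟨k, hk⟩ := hU.odd_card
  omega

end IsOddCircuit

/-- A half-integral primal solution decomposed along a partition into parts, in which it is a
combination of near-perfect matchings. -/
structure IsDecomposition (G : SimpleGraph V) (F : Finset (Finset V)) (x : Sym2 V → ℝ)
    (B : V → Finset V) (m : Finset V → V → Finset (Sym2 V)) : Prop where
  odd : IsOddFamily F
  feasible : IsPrimalFeasible G F x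
  half : ∀ e, 0 < x e → 1 / 2 ≤ x e
  nodeMap : IsNodeMap F B
  system : IsMatchingSystem G F m
  sum_cut : ∀ v, ∑ e ∈ cut G (B v), x e = 1
  eq_lift : x = lift G B m (outer B x)

namespace IsDecomposition

variable {B : V → Finset V} {m : Finset V → V → Finset (Sym2 V)} {U : Finset V}

theorem adj_of_pos (hD : IsDecomposition G F x B m) {a b : V} (h : 0 < x s(a, b)) :
    G.Adj a b := by
  by_contra hcon
  exact h.ne' (hD.feasible.eq_zero _ hcon)

/-- The matching of the part missing `a` lies in `supp(x)`, and no support edge leaves `U`, so it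
pairs up the vertices of `U ∩ B a` other than `a`. The vertex `a` itself need not lie in `U`. -/
theorem even_card_of_leaving (hD : IsDecomposition G F x B m) (hU : IsOddCircuit G x U)
    {a b : V} (hb : b ∉ B a) (hab : 0 < x s(a, b)) : Even ((U ∩ B a).erase a).card := by
  have hB := hD.nodeMap
  have hM := hD.system.matching _ (hB.mem a) a (hB.self a)
  have hadj := hD.adj_of_pos hab
  have hpos : ∀ f ∈ m (B a) a, 0 < x f := fun f hf =>
    hB.pos_of_mem_matching hD.feasible.nonneg hD.eq_lift
      (mem_cut_singleton.2 ⟨hadj, Sym2.mem_mk_left a b⟩)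
      (mk_mem_cut.2 ⟨hadj, Or.inl ⟨hB.self a, hb⟩⟩) hab hf
  have hempty : m (B a) a ∩ cut G (U ∩ B a) = ∅ := by
    rw [Finset.eq_empty_iff_forall_notMem]
    intro e he
    rw [Finset.mem_inter, mem_cut] at he
    obtain ⟨hem, -, p, q, hp, hq, rfl⟩ := he
    refine hq (Finset.mem_inter.2 ⟨?_, ?_⟩)
    · exact hU.mem_of_pos hD.feasible hD.half (Finset.mem_inter.1 hp).1 (hpos _ hem)
    · exact (Finset.mem_sdiff.1 (hM.mem_of_mem hem (Sym2.mem_mk_right _ _))).1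
  have := hM.even_card_of_inter_cut hempty
  convert this using 2
  ext w
  simp only [Finset.mem_erase, Finset.mem_inter, Finset.mem_sdiff, Finset.mem_singleton]
  tauto

/-- If `U` lies inside the part, some support edge leaves the part because its cut has value one;
were its inner end outside `U`, then `U` would be even. -/
theorem exists_leaving (hD : IsDecomposition G F x B m) (hU : IsOddCircuit G x U) {v : V}
    (hv : (U ∩ B v).Nonempty) : ∃ a ∈ U, B a = B v ∧ ∃ b, b ∉ B a ∧ 0 < x s(a, b) := by
  have hB := hD.nodeMap
  by_cases hUB : U ⊆ B v
  · have hpos : ∃ e ∈ cut G (B v), 0 < x e := by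
      by_contra hcon
      push Not at hcon
      have := Finset.sum_nonpos hcon
      rw [hD.sum_cut] at this
      linarith
    obtain ⟨e, he, hxe⟩ := hpos
    obtain ⟨-, a, b, ha, hb, rfl⟩ := mem_cut.1 he
    have hav := hB.eq a v ha
    rw [← hav] at hb
    by_cases haU : a ∈ U
    · exact ⟨a, haU, hav, b, hb, hxe⟩
    · have h1 := hD.even_card_of_leaving hU hb hxe
      rw [Finset.erase_eq_of_notMem (by simp [haU]), hav, Finset.inter_eq_left.2 hUB] at h1
      exact absurd hU.odd_card (Nat.not_odd_iff_even.2 h1)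
  · obtain ⟨a, haU, haB, b, hb, hab⟩ := hU.exists_cross hv hUB
    have hav := hB.eq a v haB
    exact ⟨a, haU, hav, b, hav ▸ hb, hab⟩

theorem odd_card_inter (hD : IsDecomposition G F x B m) (hU : IsOddCircuit G x U) {v : V}
    (hv : (U ∩ B v).Nonempty) : Odd (U ∩ B v).card := by
  obtain ⟨a, haU, hav, b, hb, hab⟩ := hD.exists_leaving hU hv
  have h1 := hD.even_card_of_leaving hU hb hab
  have ha : a ∈ U ∩ B a := Finset.mem_inter.2 ⟨haU, hD.nodeMap.self a⟩
  have hpos := Finset.card_pos.2 ⟨a, ha⟩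
  rw [Finset.card_erase_of_mem ha, Nat.even_sub (by omega)] at h1
  rw [← hav, ← Nat.not_even_iff_odd]
  simp_all

/-- A leaving vertex of `U` must belong to `U'` too, since otherwise `U'` would meet the part in an
even number of vertices. -/
theorem circuit_unique (hD : IsDecomposition G F x B m) (hU : IsOddCircuit G x U)
    {U' : Finset V} (hU' : IsOddCircuit G x U') {v : V} (hv : (U ∩ B v).Nonempty)
    (hv' : (U' ∩ B v).Nonempty) : U = U' := by
  obtain ⟨a, haU, hav, b, hb, hab⟩ := hD.exists_leaving hU hv
  refine hU.eq_of_inter_nonempty hU' hD.feasible hD.half ⟨a, Finset.mem_inter.2 ⟨haU, ?_⟩⟩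
  by_contra haU'
  have h1 := hD.even_card_of_leaving hU' hb hab
  rw [Finset.erase_eq_of_notMem (by simp [haU']), hav] at h1
  exact absurd (hD.odd_card_inter hU' hv') (Nat.not_odd_iff_even.2 h1)

/-- The number of edges of a near-perfect matching of the circuit that leave a part. -/
theorem card_inter_cut_node (hD : IsDecomposition G F x B m) (hU : IsOddCircuit G x U)
    {u b : V} (hu : u ∈ U) (hb : b ∉ B u) (hub : 0 < x s(u, b)) {N : Finset (Sym2 V)}
    (hN : IsMatchingOn G N (U \ {u})) (hNx : ∀ e ∈ N, 0 < x e) (v : V) :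
    (N ∩ cut G (B v)).card = if (U ∩ B v).Nonempty ∧ B v ≠ B u then 1 else 0 := by
  have hB := hD.nodeMap
  have hpar := hN.card_inter_eq (B v)
  have hset : U \ {u} ∩ B v = (U ∩ B v).erase u := by
    rw [Finset.sdiff_singleton_eq_erase, Finset.erase_inter]
  rw [hset] at hpar
  have hbound : ∀ A ⊆ cut G (B v), (∀ e ∈ A, 0 < x e) → A.card ≤ 2 := by
    intro A hA hAx
    have h1 := Finset.sum_le_sum_of_subset_of_nonneg (f := x) hA
      fun e _ _ => hD.feasible.nonneg e
    rw [hD.sum_cut] at h1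
    have h2 := Finset.card_nsmul_le_sum A x (1 / 2) fun e he => hD.half e (hAx e he)
    rw [nsmul_eq_mul] at h2
    have : (A.card : ℝ) ≤ 2 := by linarith
    exact_mod_cast this
  by_cases hv : (U ∩ B v).Nonempty
  · have hodd := hD.odd_card_inter hU hv
    by_cases hvu : B v = B u
    · rw [if_neg (by tauto)]
      have hmem : u ∈ U ∩ B v := Finset.mem_inter.2 ⟨hu, hB.mem_iff.2 hvu.symm⟩
      have hnot : s(u, b) ∉ N := fun h => by
        simpa using hN.mem_of_mem h (Sym2.mem_mk_left u b)
      -- The edge at the omitted vertex `u` takes one of the two places in the cut; `N` has at most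
      -- one crossing left, and parity excludes it.
      have h1 := hbound (insert s(u, b) (N ∩ cut G (B v))) (by
        intro e he
        rcases Finset.mem_insert.1 he with rfl | he
        · rw [hvu, mk_mem_cut]
          exact ⟨hD.adj_of_pos hub, Or.inl ⟨hB.self u, hb⟩⟩
        · exact (Finset.mem_inter.1 he).2) (by
        intro e he
        rcases Finset.mem_insert.1 he with rfl | he
        exacts [hub, hNx e (Finset.mem_inter.1 he).1])
      rw [Finset.card_insert_of_notMem (fun h => hnot (Finset.mem_inter.1 h).1)] at h1
      rw [Finset.card_erase_of_mem hmem] at hpar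
      obtain ⟨k, hk⟩ := hodd
      omega
    · rw [if_pos ⟨hv, hvu⟩]
      have h1 := hbound (N ∩ cut G (B v)) Finset.inter_subset_right
        fun e he => hNx e (Finset.mem_inter.1 he).1
      rw [Finset.erase_eq_of_notMem fun h => hvu (hB.eq _ _ (Finset.mem_inter.1 h).2).symm]
        at hpar
      obtain ⟨k, hk⟩ := hodd
      omega
  · rw [if_neg (by tauto)]
    rw [Finset.not_nonempty_iff_eq_empty.1 hv] at hpar
    rw [Finset.erase_empty, Finset.card_empty] at hpar
    omega

/-- Near-perfect matchings of the union of the parts that meet an odd circuit. -/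
theorem exists_matching_hull (hD : IsDecomposition G F x B m) (hU : IsOddCircuit G x U)
    {W : Finset V} (hW : ∀ w, w ∈ W ↔ (U ∩ B w).Nonempty) {u : V} (hu : u ∈ W) :
    ∃ M : Finset (Sym2 V), IsMatchingOn G M (W \ {u}) ∧
      (∀ e ∈ M, 0 < x e ∨ ∃ v, e ∈ m (B v) v) ∧
      ∀ T ∈ singletons V ∪ F, (∃ v, T ⊆ B v) → (M ∩ cut G T).card ≤ 1 := by
  classical
  have hB := hD.nodeMap
  obtain ⟨a, haU, hau, b, hb, hab⟩ := hD.exists_leaving hU ((hW u).1 hu)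
  obtain ⟨N, hN, hNx⟩ := hU.near a haU
  let y : Sym2 V → ℕ := outer B fun e => if e ∈ N then 1 else 0
  -- `N` misses a vertex `a` of the part of `u` at which the cycle leaves it, so `y` does not enter
  -- this part; there the matching missing the prescribed `u` is used instead.
  let z : Sym2 V → ℕ := fun e => lift G B m y e + if e ∈ m (B u) u then 1 else 0
  have hyB : ∀ v, ∑ e ∈ cut G (B v), y e =
      if (U ∩ B v).Nonempty ∧ B v ≠ B u then 1 else 0 := by
    intro v
    rw [hB.sum_cut_outer, ← card_inter_eq_sum, hD.card_inter_cut_node hU haU hb hab hN hNx, hau]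
  have hzT : ∀ T ∈ singletons V ∪ F, ∀ v, T ⊆ B v → ∑ e ∈ cut G T, z e =
      (if (U ∩ B v).Nonempty ∧ B v ≠ B u then 1 else 0) +
        if T ⊆ B u ∧ u ∉ T then 1 else 0 := by
    intro T hT v hTv
    simp only [z]
    rw [Finset.sum_add_distrib, hB.sum_cut_lift_of_subset hD.odd hD.system
      (isOuter_outer _) hT hTv, hyB, ← card_inter_eq_sum,
      hD.system.card _ (hB.mem u) u (hB.self u) T hT]
  have hzle : ∀ T ∈ singletons V ∪ F, (∃ v, T ⊆ B v) → ∑ e ∈ cut G T, z e ≤ 1 := by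
    rintro T hT ⟨v, hTv⟩
    rw [hzT T hT v hTv]
    by_cases hTu : T ⊆ B u
    · obtain ⟨w, hw⟩ := hD.odd.nonempty hT
      have : B v = B u := (hB.eq _ _ (hTv hw)).symm.trans (hB.eq _ _ (hTu hw))
      rw [if_neg (by tauto), zero_add]
      split_ifs <;> simp
    · rw [if_neg (show ¬ (T ⊆ B u ∧ u ∉ T) by tauto), add_zero]
      split_ifs <;> simp
  have hsing : ∀ w, ∃ v, {w} ⊆ B v := fun w =>
    ⟨w, Finset.singleton_subset_iff.2 (hB.self w)⟩
  have hz1 : ∀ e ∈ G.edgeSet, z e ≤ 1 := by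
    intro e he
    obtain ⟨w, hw⟩ : ∃ w, w ∈ e := ⟨_, Sym2.out_fst_mem e⟩
    exact (Finset.single_le_sum (f := z) (fun _ _ => Nat.zero_le _)
      (mem_cut_singleton.2 ⟨he, hw⟩)).trans (hzle _ (singleton_mem F w) (hsing w))
  let M : Finset (Sym2 V) := Finset.univ.filter fun e => z e ≠ 0
  have hMcard : ∀ T, (M ∩ cut G T).card = ∑ e ∈ cut G T, z e := by
    intro T
    rw [card_inter_eq_sum]
    refine Finset.sum_congr rfl fun e he => ?_
    have := hz1 e (mem_edgeSet_of_mem_cut he)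
    simp only [M, Finset.mem_filter, Finset.mem_univ, true_and]
    split_ifs <;> omega
  have hMmem : ∀ e ∈ M, e ∈ N ∨ ∃ v, e ∈ m (B v) v := by
    intro e he
    by_contra hcon
    push Not at hcon
    have hy : y e = 0 := by
      simp only [y, outer, if_neg hcon.1, ite_self]
    refine (Finset.mem_filter.1 he).2 ?_
    simp only [z, lift, hy]
    rw [if_neg (hcon.2 u), Finset.sum_eq_zero fun v _ => if_neg (hcon.2 v), add_zero, add_zero]
  refine ⟨M, ⟨fun e he => ?_, fun w => ?_⟩, fun e he => (hMmem e he).imp_left (hNx e),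
    fun T hT hTB => ?_⟩
  · rcases hMmem e he with h | ⟨v, h⟩
    · exact hN.1 e h
    · exact (hD.system.matching _ (hB.mem v) v (hB.self v)).1 e h
  · rw [hMcard, hzT _ (singleton_mem F w) w (Finset.singleton_subset_iff.2 (hB.self w))]
    simp only [Finset.singleton_subset_iff, Finset.mem_singleton, Finset.mem_sdiff, hW]
    by_cases hwu : B w = B u
    · have h1 : (U ∩ B w).Nonempty := hwu ▸ (hW u).1 hu
      have h2 : w ∈ B u := hB.mem_iff.2 hwu
      by_cases h : w = u
      · subst h; simp
      · simp [hwu, h2, h, Ne.symm h, hwu ▸ h1]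
    · have h2 : w ∉ B u := fun h => hwu (hB.eq _ _ h)
      have h3 : w ≠ u := fun h => hwu (h ▸ rfl)
      simp [hwu, h2, h3]
  · rw [hMcard]; exact hzle T hT hTB

end IsDecomposition

end Circuit

/-! ### Criticality of the next cut family -/

section NextCuts

set_option linter.unusedSectionVars false

variable {V : Type*} [Fintype V] [DecidableEq V] {G : SimpleGraph V} {c : Sym2 V → ℝ}
  {F : Finset (Finset V)} {Γ P : Finset V → ℝ} {x : Sym2 V → ℝ}

theorem mem_oldCuts {S : Finset V} : S ∈ oldCuts F P ↔ S ∈ F ∧ 0 < P S := by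
  simp [oldCuts]

theorem mem_newCuts {S : Finset V} :
    S ∈ newCuts F P x ↔ ∃ U, IsOddCycleSet x U ∧ hull (oldCuts F P) U = S := by
  simp [newCuts]

theorem mem_hull {K : Finset (Finset V)} {U : Finset V} {w : V} :
    w ∈ hull K U ↔ w ∈ U ∨ ∃ S, (Maximal (fun T => T ∈ K) S ∧ (S ∩ U).Nonempty) ∧ w ∈ S := by
  simp only [hull, Finset.mem_union, Finset.mem_biUnion, Finset.mem_filter, id]
  refine or_congr_right (exists_congr fun S => and_congr_left fun _ => ?_)
  exact ⟨fun h => h.2, fun h => ⟨h.1.prop, h⟩⟩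

/-- The parts are the maximal members of `K` and the uncovered singletons, so the hull is the union
of the parts meeting `U`. -/
theorem mem_hull_iff {B : V → Finset V} (hB : IsNodeMap F B) {K : Finset (Finset V)}
    (hBK : ∀ v, B v ∈ singletons V ∪ K)
    (hBmax : ∀ S ∈ singletons V ∪ K, ∀ v ∈ S, S ⊆ B v) {U : Finset V} {w : V} :
    w ∈ hull K U ↔ (U ∩ B w).Nonempty := by
  rw [mem_hull]
  constructor
  · rintro (h | ⟨S, ⟨hS, u, hu⟩, hwS⟩)
    · exact ⟨w, Finset.mem_inter.2 ⟨h, hB.self w⟩⟩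
    · rw [Finset.mem_inter] at hu
      exact ⟨u, Finset.mem_inter.2
        ⟨hu.2, hBmax S (Finset.mem_union_right _ hS.prop) w hwS hu.1⟩⟩
  · rintro ⟨u, hu⟩
    rw [Finset.mem_inter] at hu
    rcases Finset.mem_union.1 (hBK w) with h | h
    · obtain ⟨v, hv⟩ := mem_singletons.1 h
      have h1 := hB.self w
      rw [← hv, Finset.mem_singleton] at h1
      rw [← hv, Finset.mem_singleton] at hu
      exact Or.inl (h1.trans hu.2.symm ▸ hu.1)
    · refine Or.inr ⟨B w, ⟨⟨h, fun T hT hle => ?_⟩, ⟨u, ?_⟩⟩, hB.self w⟩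
      · exact hBmax T (Finset.mem_union_right _ hT) w (hle (hB.self w))
      · exact Finset.mem_inter.2 ⟨hu.2, hu.1⟩

theorem dualLoad_eq_sum_univ (h : ∀ S, S ∉ singletons V ∪ F → P S = 0) (e : Sym2 V) :
    dualLoad G F P e = ∑ S, if e ∈ cut G S then P S else 0 := by
  rw [dualLoad_eq_sum_ite]
  refine Finset.sum_subset (Finset.subset_univ _) fun S _ hS => ?_
  rw [h S hS, ite_self]

/-- The next cut family is critical, with the extremal dual as a critical dual. -/
theorem IsExtremalDual.isCriticalDual_nextCuts (hF : IsCriticalFamily G c F)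
    (hΓ : IsCriticalDual G c F Γ) (hP : IsExtremalDual G c F Γ P)
    (hx : IsUniquePrimalOptimal G c F x) :
    IsCriticalFamily G c (nextCuts F P x) ∧ IsCriticalDual G c (nextCuts F P x) P := by
  classical
  obtain ⟨m, hm, hmt⟩ := hΓ.exists_matchingSystem hF
  have hxf := hx.1.1
  obtain ⟨hslackE, hslackS⟩ := hx.complementary hP.1 hF.odd
  have hold : oldCuts F P ⊆ F := fun S hS => (mem_oldCuts.1 hS).1
  obtain ⟨B, hB, hBK, hBmax⟩ := exists_nodeMap hF.laminar
    (K := singletons V ∪ oldCuts F P) Finset.subset_union_left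
    (Finset.union_subset_union_right hold)
  have hBx : ∀ v, ∑ e ∈ cut G (B v), x e = 1 := by
    intro v
    rcases Finset.mem_union.1 (hBK v) with h | h
    · obtain ⟨w, hw⟩ := mem_singletons.1 h
      rw [← hw]; exact hxf.degree w
    · exact hslackS _ (mem_oldCuts.1 h).1 (mem_oldCuts.1 h).2
  have hhalf : ∀ e, 0 < x e → 1 / 2 ≤ x e := by
    intro e he
    obtain ⟨k, hk⟩ := hx.half_integral hF e
    have hk0 : k ≠ 0 := by
      rintro rfl
      simp [hk] at he
    have : (1 : ℝ) ≤ k := by exact_mod_cast Nat.one_le_iff_ne_zero.2 hk0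
    rw [hk]; linarith
  have hD : IsDecomposition G F x B m := ⟨hF.odd, hxf, hhalf, hB, hm, hBx,
    hB.eq_lift_outer hF hΓ.feasible hm hmt hx hBx⟩
  have hcirc : ∀ U, IsOddCycleSet x U → IsOddCircuit G x U := fun U hU =>
    hU.isOddCircuit hxf.eq_zero
  have hhull : ∀ U w, w ∈ hull (oldCuts F P) U ↔ (U ∩ B w).Nonempty := fun U w =>
    mem_hull_iff hB hBK hBmax
  have hnode : ∀ S ∈ oldCuts F P, ∀ v ∈ S, S ⊆ B v := fun S hS =>
    hBmax S (Finset.mem_union_right _ hS)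
  -- the position of the new cuts relative to the others
  have hnewnew : ∀ S ∈ newCuts F P x, ∀ T ∈ newCuts F P x, S = T ∨ Disjoint S T := by
    intro S hS T hT
    obtain ⟨U, hU, rfl⟩ := mem_newCuts.1 hS
    obtain ⟨U', hU', rfl⟩ := mem_newCuts.1 hT
    by_cases h : Disjoint (hull (oldCuts F P) U) (hull (oldCuts F P) U')
    · exact Or.inr h
    · obtain ⟨w, h1, h2⟩ := Finset.not_disjoint_iff.1 h
      rw [hhull] at h1 h2
      exact Or.inl (by rw [hD.circuit_unique (hcirc U hU) (hcirc U' hU') h1 h2])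
  have holdnew : ∀ S ∈ oldCuts F P, ∀ T ∈ newCuts F P x, S ⊆ T ∨ Disjoint S T := by
    intro S hS T hT
    obtain ⟨U, hU, rfl⟩ := mem_newCuts.1 hT
    by_cases h : Disjoint S (hull (oldCuts F P) U)
    · exact Or.inr h
    · obtain ⟨w, h1, h2⟩ := Finset.not_disjoint_iff.1 h
      refine Or.inl fun v hv => ?_
      rw [hhull] at h2 ⊢
      rwa [hB.eq v w (hnode S hS w h1 hv)]
  -- A cycle has a support edge leaving the part, and this edge stays in the cycle; hence no
  -- retained cut contains the whole cycle.
  have hnotsub : ∀ S ∈ oldCuts F P, ∀ T ∈ newCuts F P x, ¬ T ⊆ S := by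
    intro S hS T hT hTS
    obtain ⟨U, hU, rfl⟩ := mem_newCuts.1 hT
    have hC := hcirc U hU
    have hUS : ∀ u ∈ U, u ∈ S := fun u hu =>
      hTS ((hhull U u).2 ⟨u, Finset.mem_inter.2 ⟨hu, hB.self u⟩⟩)
    obtain ⟨u, hu⟩ := hC.nonempty
    obtain ⟨a, ha, -, b, hb, hab⟩ :=
      hD.exists_leaving hC (v := u) ⟨u, Finset.mem_inter.2 ⟨hu, hB.self u⟩⟩
    exact hb (hnode S hS a (hUS a ha) (hUS b (hC.mem_of_pos hxf hhalf ha hab)))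
  have hUhull : ∀ U, U ⊆ hull (oldCuts F P) U := fun U u hu =>
    (hhull U u).2 ⟨u, Finset.mem_inter.2 ⟨hu, hB.self u⟩⟩
  have hmem : ∀ S, S ∈ nextCuts F P x ↔ S ∈ oldCuts F P ∨ S ∈ newCuts F P x := fun S =>
    Finset.mem_union
  -- the dual constraints do not change
  have hP0 : ∀ S, S ∉ singletons V ∪ nextCuts F P x → P S = 0 := by
    intro S hS
    by_contra hne
    by_cases hSF : S ∈ singletons V ∪ F
    · rcases Finset.mem_union.1 hSF with h | h
      · exact hS (Finset.mem_union_left _ h)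
      · refine hS (Finset.mem_union_right _ ((hmem S).2 (Or.inl (mem_oldCuts.2 ⟨h, ?_⟩))))
        exact (hP.1.1.nonneg S h).lt_of_ne' hne
    · exact hne (hP.1.1.eq_zero S hSF)
  have hload : ∀ e, dualLoad G (nextCuts F P x) P e = dualLoad G F P e := fun e => by
    rw [dualLoad_eq_sum_univ hP0, dualLoad_eq_sum_univ hP.1.1.eq_zero]
  have htight : tightGraph G c (nextCuts F P x) P = tightGraph G c F P := by
    simp only [tightGraph, hload]
  have hmtP : ∀ v, ∀ e ∈ m (B v) v, dualLoad G F P e = c e := by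
    intro v e he
    have hM := hm.matching _ (hB.mem v) v (hB.self v)
    rw [← hmt _ (hB.mem v) v (hB.self v) e he]
    have hin : ∀ w ∈ e, w ∈ B v \ {v} := fun w hw => hM.mem_of_mem he hw
    rcases Finset.mem_union.1 (hBK v) with h | h
    · obtain ⟨w, hw⟩ := mem_singletons.1 h
      have h1 := hin _ (Sym2.out_fst_mem e)
      have h2 := hB.self v
      rw [← hw, Finset.mem_singleton] at h2
      rw [← hw, h2] at h1
      simp at h1
    · obtain ⟨h1, h2⟩ := mem_oldCuts.1 h
      exact dualLoad_congr_of_inside hF.laminar (hB.mem v)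
        (fun T hT hTB => hP.eq_of_ssubset hF hΓ h1 h2 hT hTB)
        fun w hw => (Finset.mem_sdiff.1 (hin w hw)).1
  -- near-perfect matchings of the new cuts
  have hnewmatch : ∀ S ∈ newCuts F P x, ∀ u ∈ S, ∃ M : Finset (Sym2 V),
      IsMatchingOn G M (S \ {u}) ∧ (∀ e ∈ M, dualLoad G F P e = c e) ∧
      ∀ T ∈ oldCuts F P, (M ∩ cut G T).card ≤ 1 := by
    intro S hS u hu
    obtain ⟨U, hU, rfl⟩ := mem_newCuts.1 hS
    obtain ⟨M, hM, hMe, hMT⟩ := hD.exists_matching_hull (hcirc U hU) (hhull U) hu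
    refine ⟨M, hM, fun e he => ?_, fun T hT => ?_⟩
    · rcases hMe e he with h | ⟨v, h⟩
      exacts [hslackE e h, hmtP v e h]
    · have hT' : T ∈ singletons V ∪ F := Finset.mem_union_right _ (hold hT)
      obtain ⟨v, hv⟩ := hF.odd.nonempty hT'
      exact hMT T hT' ⟨v, hnode T hT v hv⟩
  have hodd : IsOddFamily (nextCuts F P x) := by
    intro S hS
    rcases (hmem S).1 hS with h | h
    · exact hF.odd S (hold h)
    · obtain ⟨U, hU, hUS⟩ := mem_newCuts.1 h
      have hsub : U ⊆ S := hUS ▸ hUhull U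
      have hcard := (hcirc U hU).three_le_card.trans (Finset.card_le_card hsub)
      obtain ⟨u, hu⟩ := Finset.card_pos.1 (show 0 < S.card by omega)
      obtain ⟨M, hM, -⟩ := hnewmatch S h u hu
      obtain ⟨k, hk⟩ := hM.even_card
      rw [Finset.sdiff_singleton_eq_erase, Finset.card_erase_of_mem hu] at hk
      exact ⟨⟨k, by omega⟩, hcard⟩
  have hlam : IsLaminar (nextCuts F P x) := by
    intro X hX Y hY
    rcases (hmem X).1 hX with hX | hX <;> rcases (hmem Y).1 hY with hY | hY
    · exact hF.laminar X (hold hX) Y (hold hY)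
    · rcases holdnew X hX Y hY with h | h
      exacts [Or.inr (Or.inl h), Or.inl h]
    · rcases holdnew Y hY X hX with h | h
      exacts [Or.inr (Or.inr h), Or.inl h.symm]
    · rcases hnewnew X hX Y hY with h | h
      exacts [Or.inr (Or.inl h.subset), Or.inl h]
  have hcrit : IsCriticalDual G c (nextCuts F P x) P := by
    refine ⟨⟨hP0, fun e he => ?_, fun S hS => ?_⟩, fun S hS => ?_, fun T hT hTmax => ?_⟩
    · rw [hload]; exact hP.1.1.edge e he
    · by_cases hSF : S ∈ F
      · exact hP.1.1.nonneg S hSF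
      · refine (hP.1.1.eq_zero S fun h => ?_).ge
        rcases Finset.mem_union.1 h with h | h
        · obtain ⟨v, rfl⟩ := mem_singletons.1 h
          have := (hodd _ hS).2
          simp at this
        · exact hSF h
    · rw [htight, isFactorCritical_iff tightGraph_le]
      intro u hu
      have key : ∃ M : Finset (Sym2 V), IsMatchingOn G M (S \ {u}) ∧
          (∀ e ∈ M, dualLoad G F P e = c e) ∧ ∀ T ∈ oldCuts F P, (M ∩ cut G T).card ≤ 1 := by
        rcases (hmem S).1 hS with h | h
        · obtain ⟨h1, h2⟩ := mem_oldCuts.1 h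
          obtain ⟨M, hM1, hM2, hM3⟩ := (isFactorCritical_iff tightGraph_le).1
            ((hP.isPositivelyCriticalDual hF hΓ).factorCritical S h1 h2) u hu
          exact ⟨M, hM2, fun e he => (mem_tightGraph_edgeSet.1 (hM1 e he)).2,
            fun T hT => hM3 T (hold hT)⟩
        · exact hnewmatch S h u hu
      obtain ⟨M, hM, hMe, hMT⟩ := key
      refine ⟨M, fun e he => mem_tightGraph_edgeSet.2 ⟨hM.1 e he, hMe e he⟩, hM,
        fun T hT => ?_⟩
      rcases (hmem T).1 hT with hT | hT
      · exact hMT T hT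
      · have hST : S ⊆ T ∨ Disjoint S T := by
          rcases (hmem S).1 hS with h | h
          · exact holdnew S h T hT
          · exact (hnewnew S h T hT).imp_left fun h => h.subset
        rw [hM.inter_cut_eq_empty (hST.imp (Finset.sdiff_subset.trans ·)
          (fun h => h.mono_left Finset.sdiff_subset))]
        simp
    · rcases (hmem T).1 hT with h | h
      · exact (mem_oldCuts.1 h).2
      · refine absurd ⟨hT, fun S hS hTS => ?_⟩ hTmax
        rcases (hmem S).1 hS with hS | hS
        · exact absurd hTS (hnotsub S hS T h)
        · rcases hnewnew T h S hS with h' | h'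
          · exact h'.ge
          · have h3 := (hodd T hT).2
            have := Finset.disjoint_of_subset_right hTS h'
            rw [disjoint_self] at this
            rw [this] at h3
            simp at h3
  exact ⟨⟨hodd, hlam, P, hcrit⟩, hcrit⟩

end NextCuts

end Blossom

theorem mainTheorem4 {V : Type*} [Fintype V] [DecidableEq V] (G : SimpleGraph V)
    (c : Sym2 V → ℝ) (F : Finset (Finset V)) (Γ P : Finset V → ℝ)
    (hF : Blossom.IsCriticalFamily G c F)
    (hΓ : Blossom.IsCriticalDual G c F Γ)
    (hP : Blossom.IsExtremalDual G c F Γ P) :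
    (Blossom.IsPositivelyCriticalDual G c F P ∧ Blossom.IsDualOptimal G c F P) ∧
      ∀ x : Sym2 V → ℝ, Blossom.IsUniquePrimalOptimal G c F x →
        Blossom.IsCriticalFamily G c (Blossom.nextCuts F P x) ∧
          Blossom.IsCriticalDual G c (Blossom.nextCuts F P x) P :=
  ⟨⟨hP.isPositivelyCriticalDual hF hΓ, hP.1⟩,
    fun _ hx => hP.isCriticalDual_nextCuts hF hΓ hx⟩
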